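/- Let $k$ be a positive integer. \textbf{Model.} A properly $k$-edge-coloured graph is a simple graph whose edges are coloured with colours $1,\dots,k$ so that edges sharing an endpoint have different colours. A deterministic distributed algorithm for anonymous $k$-edge-coloured graphs is a state machine, the same for every node (there are no node identifiers). The initial state of a node is a function of the set of colours of its incident edges. In every synchronous communication round each node sends along each incident edge a message that depends on its state and the colour of that edge, receives the messages of its neighbours (labelled with the edge colours), and updates its state. A node may stop initially or after any round, announcing its final local output: $\bot$ (unmatched) or the colour of the incident edge along which it is matched. States and messages range over arbitrary sets and the transitions are arbitrary functions, so message size and local computation are unlimited. The algorithm \emph{finds a maximal matching in $r$ rounds} in a graph if every node stops after at most $r$ rounds, a node with output $c\neq\bot$ has an incident edge of colour $c$ whose other endpoint also outputs $c$, and no two adjacent nodes both output $\bot$. \textbf{Theorem.} (a) If a deterministic distributed algorithm finds a maximal matching in $r$ rounds in every (even only in every finite) properly $k$-edge-coloured graph, then $r \ge k-1$. (b) The same lower bound holds for abstract local algorithms on trees. Let $G_k=\langle 1,\dots,k \mid 1^2,\dots,k^2\rangle$, and let $|x|$ be the length of the reduced form of $x\in G_k$. A $k$-colour system is a non-empty prefix-closed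 set $V\subseteq G_k$ (of reduced words), viewed as an edge-coloured tree with an edge of colour $c$ between $v$ and $vc$ whenever both lie in $V$. Let $A$ assign an output $A(V,v)\in\{\bot,1,\dots,k\}$ to every $k$-colour system $V$ and node $v\in V$, and let $r \ge 0$ be an integer such that $A(U,u)=A(V,v)$ whenever $\{x\in u^{-1}U : |x|\le r+1\}=\{x\in v^{-1}V : |x|\le r+1\}$. If in every $k$-colour system $V$ the outputs $A(V,\cdot)$ describe a maximal matching in the above sense, then $r\ge k-1$. (c) The greedy algorithm attains the bound. Let the greedy matching of a properly $k$-edge-coloured graph be obtained from $M=\emptyset$ by, for $i=1,\dots,k$ in order, adding to $M$ all edges of colour $i$ neither of whose endpoints is matched by $M$ at the beginning of step $i$. There is a deterministic distributed algorithm that in every properly $k$-edge-coloured graph finds a maximal matching in $k-1$ rounds, and this matching is the greedy matching. -/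

import Mathlib

universe u₁ u₂ u₃

/-! ### The free product of `k` cyclic groups of order two and colour systems -/

/-- The group `G_k = ⟨1, …, k ∣ 1², …, k²⟩`, the free product of `k` cyclic groups of order two.
The set of colours is `Fin k`. -/
abbrev ColourGroup (k : ℕ) : Type :=
  Monoid.CoprodI (fun _ : Fin k => Multiplicative (ZMod 2))

namespace ColourGroup

variable {k : ℕ}

/-- The generator of colour `c`, an involution. -/
def gen (c : Fin k) : ColourGroup k :=
  Monoid.CoprodI.of (M := fun _ : Fin k => Multiplicative (ZMod 2)) (i := c)
    (Multiplicative.ofAdd 1)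

/-- The norm `|x|`: the length of the reduced form of `x`. -/
def len (x : ColourGroup k) : ℕ :=
  (Monoid.CoprodI.Word.equiv x).toList.length

end ColourGroup

/-- A `k`-colour system: a non-empty prefix-closed subset of `G_k`. The condition
`|v c| + 1 = |v|` says that `c` is the last letter of the reduced form of `v`, and then `v c` is
the predecessor of `v`. The system stands for the properly `k`-edge-coloured tree on the node set
`carrier` in which `v` and `v c` are joined by an edge of colour `c` whenever both are nodes. -/
structure ColourSystem (k : ℕ) where
  carrier : Set (ColourGroup k)
  nonempty : carrier.Nonempty
  pred_mem : ∀ v ∈ carrier, ∀ c : Fin k,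
    ColourGroup.len (v * ColourGroup.gen c) + 1 = ColourGroup.len v →
      v * ColourGroup.gen c ∈ carrier

/-- The set `(v⁻¹ V)[h]`: the radius-`h` neighbourhood of `v` in the colour system `V`, recentred
at `v`. -/
def ColourSystem.view {k : ℕ} (V : ColourSystem k) (v : V.carrier) (h : ℕ) :
    Set (ColourGroup k) :=
  {x | (v : ColourGroup k) * x ∈ V.carrier ∧ ColourGroup.len x ≤ h}

/-- A function that associates a local output with each node of each colour system. The output is
`some c` for a node that is matched along its edge of colour `c`, and `none` for an unmatched
node. -/
abbrev LocalOutput (k : ℕ) : Type :=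
  (V : ColourSystem k) → V.carrier → Option (Fin k)

namespace LocalOutput

variable {k : ℕ}

/-- `A` is a distributed algorithm with running time `r`: the output of a node is determined by its
recentred neighbourhood of radius `r + 1`. -/
def HasRunningTime (A : LocalOutput k) (r : ℕ) : Prop :=
  ∀ (U V : ColourSystem k) (u : U.carrier) (v : V.carrier),
    U.view u (r + 1) = V.view v (r + 1) → A U u = A V v

/-- `A` finds a maximal matching in the colour system `V`. -/
def FindsMaximalMatching (A : LocalOutput k) (V : ColourSystem k) : Prop :=
  (∀ (v : V.carrier) (c : Fin k), A V v = some c →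
    ∃ h : (v : ColourGroup k) * ColourGroup.gen c ∈ V.carrier, A V ⟨_, h⟩ = some c) ∧
  (∀ (v : V.carrier) (c : Fin k) (h : (v : ColourGroup k) * ColourGroup.gen c ∈ V.carrier),
    A V v = none → A V ⟨_, h⟩ ≠ none)

end LocalOutput

/-! ### Edge-coloured graphs and the greedy matching -/

/-- A simple graph with a proper edge colouring with `k` colours. -/
structure EdgeColouredGraph (k : ℕ) (V : Type*) where
  graph : SimpleGraph V
  colour : graph.EdgeLabeling (Fin k)
  proper : ∀ (u v w : V) (hv : graph.Adj u v) (hw : graph.Adj u w),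
    colour.get u v hv = colour.get u w hw → v = w

namespace EdgeColouredGraph

variable {k : ℕ} {V : Type*}

/-- There is an edge of colour `c` between `u` and `v`. -/
def Link (G : EdgeColouredGraph k V) (c : Fin k) (u v : V) : Prop :=
  ∃ h : G.graph.Adj u v, G.colour.get u v h = c

/-- The local outputs `o` describe a maximal matching of `G`, where `o v = some c` means that `v`
is matched along its edge of colour `c`, and `o v = none` that `v` is unmatched. -/
def IsMaximalMatching (G : EdgeColouredGraph k V) (o : V → Option (Fin k)) : Prop :=
  (∀ v c, o v = some c → ∃ w, G.Link c v w ∧ o w = some c) ∧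
  (∀ v w, G.graph.Adj v w → o v = none → o w ≠ none)

/-- The greedy matching after the first `i` steps: start with no edges, and in the step of colour
`i` add all edges of this colour neither of whose endpoints is matched so far. -/
def greedySteps (G : EdgeColouredGraph k V) : ℕ → Set (Sym2 V)
  | 0 => ∅
  | i + 1 => G.greedySteps i ∪
      {e | ∃ (c : Fin k) (u v : V), (c : ℕ) = i ∧ G.Link c u v ∧ e = s(u, v) ∧
        ∀ f ∈ G.greedySteps i, u ∉ f ∧ v ∉ f}

/-- The matching that the greedy algorithm finds, going through all `k` colours in order. -/
def greedyMatching (G : EdgeColouredGraph k V) : Set (Sym2 V) :=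
  G.greedySteps k

end EdgeColouredGraph

/-! ### Synchronous message passing in anonymous edge-coloured networks -/

/-- A deterministic distributed algorithm for anonymous `k`-edge-coloured networks. All nodes run
the same state machine. States and messages are arbitrary types and all maps are arbitrary
functions: neither message size nor local computation is limited.
* `start C` is the initial state of a node whose incident edges have the set `C` of colours;
* `send s c` is the message that a node in state `s` sends along its edge of colour `c`;
* `update s m` is the new state of a node that was in state `s` and received the message `m c`
  along its edge of colour `c` (`m c = none` if it has no such edge);
* `output s` is `none` if a node in state `s` is still running, and `some o` if it has stopped with
  local output `o`. -/
structure MessagePassing (k : ℕ) where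
  State : Type u₁
  Message : Type u₂
  start : Set (Fin k) → State
  send : State → Fin k → Message
  update : State → (Fin k → Option Message) → State
  output : State → Option (Option (Fin k))

namespace MessagePassing

variable {k : ℕ} {V : Type*}

open Classical in
/-- The messages that `v` receives, by colour of the edge, when `s` is the state of each node. -/
noncomputable def inbox (A : MessagePassing k) (G : EdgeColouredGraph k V) (s : V → A.State)
    (v : V) (c : Fin k) : Option A.Message :=
  if h : ∃ w, G.Link c v w then some (A.send (s h.choose) c) else none

open Classical in
/-- The state of each node of `G` after `t` synchronous communication rounds. The state of a node
that has stopped does not change any more, so that its local output is final. (Its neighbours keep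
receiving the messages determined by that state, so they can learn that it has stopped.) -/
noncomputable def state (A : MessagePassing k) (G : EdgeColouredGraph k V) : ℕ → V → A.State
  | 0, v => A.start {c | ∃ w, G.Link c v w}
  | t + 1, v =>
      if A.output (A.state G t v) = none then
        A.update (A.state G t v) (A.inbox G (A.state G t) v)
      else A.state G t v

/-- In the execution of `A` in `G`, each node stops after at most `r` communication rounds, and
`o v` is the local output of the node `v`. -/
def StopsWithin (A : MessagePassing k) (G : EdgeColouredGraph k V) (r : ℕ)
    (o : V → Option (Fin k)) : Prop :=
  ∀ v, A.output (A.state G r v) = some (o v)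

end MessagePassing

/-! Lower bound. Loops of an edge-coloured multigraph unfold to edges of its universal cover, and
both ends of such an edge look alike; so a node with a loop cannot be unmatched. A template is a
part of the Cayley tree in which every node lacks one chosen colour and has loops of all other
unused colours. The aim is a `Critical` pair for each h from 1 to k - 1: two h-regular templates,
equal to radius h around the root, whose root is matched along a template edge in only one of them.
Such a pair forces h ≤ r (`Critical.lt`), and h = k - 1 gives the bound.

The induction (`Critical.exists_succ`) takes a colour c such that the root of T is matched along its
loop of colour c. Unfolding one loop at every node, of colour c at the root, raises the degree by
one. Then one half of one unfolded template, cut at the root edge c, is grafted onto the other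
(`exists_critical_of_graft`). Whatever the algorithm does on the root edge of the graft, it differs
there from its behaviour on one of the originals, which is equal to the graft on one side of the
edge. The difference spreads along an alternating path on that side; if every node were internally
matched in both or in neither, the path would run beyond the reach of the algorithm
(`exists_internal_ne`). The node where it stops is the new root.

The base case uses single edges and needs three colours (`exists_critical_one`); k = 2 is settled by
a star. Message passing reduces to local outputs because r rounds reveal only radius r + 1, so
finite balls suffice.

Upper bound. The greedy step of the first colour needs no communication, and each later colour costs
one round. -/

namespace ColourGroup

variable {k : ℕ}

/-! ### Reduced words and branches in the free product. -/

/-- The product of the generators in a list of colours. -/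
def ofWord (l : List (Fin k)) : ColourGroup k :=
  (l.map gen).prod

/-- The reduced word of an element, as a list of colours. -/
def word (x : ColourGroup k) : List (Fin k) :=
  (Monoid.CoprodI.Word.equiv x).toList.map Sigma.fst

@[simp] theorem ofWord_nil : ofWord ([] : List (Fin k)) = 1 := rfl

@[simp] theorem ofWord_cons (c : Fin k) (l : List (Fin k)) :
    ofWord (c :: l) = gen c * ofWord l := by
  simp [ofWord]

theorem ofWord_append (l₁ l₂ : List (Fin k)) : ofWord (l₁ ++ l₂) = ofWord l₁ * ofWord l₂ := by
  simp [ofWord]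

theorem ofWord_concat (l : List (Fin k)) (c : Fin k) : ofWord (l ++ [c]) = ofWord l * gen c := by
  simp [ofWord_append]

theorem length_word (x : ColourGroup k) : (word x).length = len x := by
  simp [word, len]

theorem gen_mul_gen (c : Fin k) : gen c * gen c = 1 := by
  unfold gen
  rw [← map_mul, ← ofAdd_add]
  have : (1 + 1 : ZMod 2) = 0 := by decide
  rw [this, ofAdd_zero, map_one]

@[simp] theorem gen_mul_gen_mul (c : Fin k) (x : ColourGroup k) : gen c * (gen c * x) = x := by
  rw [← mul_assoc, gen_mul_gen, one_mul]

@[simp] theorem mul_gen_mul_gen (x : ColourGroup k) (c : Fin k) : x * gen c * gen c = x := by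
  rw [mul_assoc, gen_mul_gen, mul_one]

theorem isChain_word (x : ColourGroup k) : (word x).IsChain (· ≠ ·) := by
  unfold word
  rw [List.isChain_map]
  exact (Monoid.CoprodI.Word.equiv x).chain_ne

theorem word_ofWord {l : List (Fin k)} (h : l.IsChain (· ≠ ·)) : word (ofWord l) = l := by
  let W : Monoid.CoprodI.Word (fun _ : Fin k => Multiplicative (ZMod 2)) :=
    { toList := l.map fun c => ⟨c, Multiplicative.ofAdd 1⟩
      ne_one := by
        intro m hm
        obtain ⟨c, -, rfl⟩ := List.mem_map.1 hm
        change (Multiplicative.ofAdd (1 : ZMod 2)) ≠ 1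
        decide
      chain_ne := by
        rw [List.isChain_map]
        exact h }
  have hW : ofWord l = Monoid.CoprodI.Word.equiv.symm W := by
    change _ = W.prod
    simp [Monoid.CoprodI.Word.prod, W, ofWord, Function.comp_def]
    rfl
  rw [hW, word, Equiv.apply_symm_apply]
  simp [W, Function.comp_def]

-- Keeping only the colours of the syllables loses nothing, since `ZMod 2` has a single nontrivial
-- element.
@[simp] theorem ofWord_word (x : ColourGroup k) : ofWord (word x) = x := by
  conv_rhs => rw [← Monoid.CoprodI.Word.equiv.symm_apply_apply x]
  change _ = (Monoid.CoprodI.Word.equiv x).prod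
  unfold ofWord word Monoid.CoprodI.Word.prod
  rw [List.map_map]
  congr 1
  apply List.map_congr_left
  rintro ⟨c, m⟩ hm
  have h1 : m ≠ 1 := (Monoid.CoprodI.Word.equiv x).ne_one _ hm
  have h2 : ∀ m : Multiplicative (ZMod 2), m ≠ 1 → m = Multiplicative.ofAdd 1 := by decide
  rw [h2 m h1]
  rfl

@[simp] theorem word_one : word (1 : ColourGroup k) = [] :=
  word_ofWord (l := []) List.isChain_nil

@[simp] theorem word_gen (c : Fin k) : word (gen c) = [c] := by
  simpa using word_ofWord (l := [c]) (List.isChain_singleton c)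

theorem gen_injective : Function.Injective (gen : Fin k → ColourGroup k) := by
  intro c d h
  simpa using congrArg word h

theorem gen_ne_one (c : Fin k) : gen c ≠ 1 := by
  intro h
  simpa using congrArg word h

theorem eq_of_gen_mul_gen_eq_one {c d : Fin k} (h : gen c * gen d = 1) : c = d := by
  rw [mul_eq_one_iff_eq_inv, inv_eq_of_mul_eq_one_left (gen_mul_gen _)] at h
  exact gen_injective h

theorem word_gen_mul_of_head?_ne {c : Fin k} {x : ColourGroup k} (h : (word x).head? ≠ some c) :
    word (gen c * x) = c :: word x := by
  have : (c :: word x).IsChain (· ≠ ·) := by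
    rw [List.isChain_cons]
    refine ⟨fun y hy hcy => h ?_, isChain_word x⟩
    rw [hcy]; exact hy
  simpa using word_ofWord this

theorem word_gen_mul_of_cons {c : Fin k} {x : ColourGroup k} {l : List (Fin k)}
    (h : word x = c :: l) : word (gen c * x) = l := by
  have hl : l.IsChain (· ≠ ·) := by
    have := isChain_word x
    rw [h] at this
    exact this.tail
  have hx : gen c * x = ofWord l := by
    rw [← ofWord_word x, h]; simp
  rw [hx, word_ofWord hl]

theorem word_mul_gen_of_getLast?_ne {c : Fin k} {x : ColourGroup k}
    (h : (word x).getLast? ≠ some c) : word (x * gen c) = word x ++ [c] := by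
  have : (word x ++ [c]).IsChain (· ≠ ·) := by
    rw [List.isChain_append]
    refine ⟨isChain_word x, List.isChain_singleton c, ?_⟩
    rintro y hy z hz rfl
    simp at hz
    subst hz
    exact h hy
  simpa [ofWord_concat] using word_ofWord this

theorem word_mul_gen_of_concat {c : Fin k} {x : ColourGroup k} {l : List (Fin k)}
    (h : word x = l ++ [c]) : word (x * gen c) = l := by
  have hl : l.IsChain (· ≠ ·) := by
    have := isChain_word x
    rw [h] at this
    exact this.left_of_append
  have hx : x * gen c = ofWord l := by
    rw [← ofWord_word x, h]; simp [ofWord_concat]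
  rw [hx, word_ofWord hl]

/-- Right multiplication by a generator either appends this letter to the reduced word or removes
it from the end. -/
theorem word_mul_gen (x : ColourGroup k) (c : Fin k) :
    word (x * gen c) = word x ++ [c] ∨ word x = word (x * gen c) ++ [c] := by
  by_cases h : (word x).getLast? = some c
  · right
    obtain ⟨l, hl⟩ := List.getLast?_eq_some_iff.1 h
    rw [word_mul_gen_of_concat hl, hl]
  · exact Or.inl (word_mul_gen_of_getLast?_ne h)

@[simp] theorem len_one : len (1 : ColourGroup k) = 0 := by
  simp [← length_word]

@[simp] theorem len_gen (c : Fin k) : len (gen c) = 1 := by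
  simp [← length_word]

theorem len_mul_gen_le (x : ColourGroup k) (c : Fin k) : len (x * gen c) ≤ len x + 1 := by
  rcases word_mul_gen x c with h | h <;> have := congrArg List.length h <;>
    simp [length_word] at this <;> omega

theorem len_le_len_mul_gen (x : ColourGroup k) (c : Fin k) : len x ≤ len (x * gen c) + 1 := by
  simpa using len_mul_gen_le (x * gen c) c

theorem len_gen_mul_le (c : Fin k) (x : ColourGroup k) : len (gen c * x) ≤ len x + 1 := by
  simp only [← length_word]
  by_cases h : (word x).head? = some c
  · obtain ⟨l, hl⟩ := List.head?_eq_some_iff.1 h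
    rw [word_gen_mul_of_cons hl, hl]
    simp; omega
  · rw [word_gen_mul_of_head?_ne h]; simp

theorem len_mul_le (x y : ColourGroup k) : len (x * y) ≤ len x + len y := by
  have key : ∀ l : List (Fin k), len (x * ofWord l) ≤ len x + l.length := by
    intro l
    induction l using List.reverseRecOn with
    | nil => simp
    | append_singleton l d ih =>
      have := len_mul_gen_le (x * ofWord l) d
      rw [ofWord_concat, ← mul_assoc, List.length_append, List.length_singleton]
      omega
  simpa [length_word] using key (word y)

theorem eq_one_of_len_eq_zero {x : ColourGroup k} (h : len x = 0) : x = 1 := by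
  rw [← length_word, List.length_eq_zero_iff] at h
  rw [← ofWord_word x, h, ofWord_nil]

/-- The elements whose reduced word begins with the letter `c`. -/
def Branch (c : Fin k) (x : ColourGroup k) : Prop :=
  (word x).head? = some c

@[simp] theorem not_branch_one (c : Fin k) : ¬ Branch c 1 := by
  simp [Branch]

@[simp] theorem branch_gen (c : Fin k) : Branch c (gen c) := by
  simp [Branch]

@[simp] theorem branch_gen_mul (c : Fin k) (x : ColourGroup k) :
    Branch c (gen c * x) ↔ ¬ Branch c x := by
  by_cases h : Branch c x
  · obtain ⟨l, hl⟩ := List.head?_eq_some_iff.1 h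
    simp only [h, not_true, iff_false]
    unfold Branch
    rw [word_gen_mul_of_cons hl]
    have := isChain_word x
    rw [hl, List.isChain_cons] at this
    intro hh
    exact this.1 c hh rfl
  · simp only [h, not_false_eq_true, iff_true]
    unfold Branch
    rw [word_gen_mul_of_head?_ne h]
    rfl

/-- The only edge that enters a branch is the one at its root. -/
theorem eq_of_branch_mul_gen {c d : Fin k} {x : ColourGroup k} (h₁ : ¬ Branch c x)
    (h₂ : Branch c (x * gen d)) : x = 1 ∧ d = c := by
  unfold Branch at *
  rcases word_mul_gen x d with h | h
  · rw [h] at h₂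
    cases hx : word x with
    | nil =>
      rw [hx] at h₂
      refine ⟨eq_one_of_len_eq_zero ?_, by simpa using h₂⟩
      rw [← length_word, hx]; rfl
    | cons e l =>
      rw [hx] at h₁ h₂
      exact absurd (by simpa using h₂) h₁
  · rw [h] at h₁
    cases hx : word (x * gen d) with
    | nil => rw [hx] at h₂; simp at h₂
    | cons e l =>
      rw [hx] at h₁ h₂
      exact absurd (by simpa using h₂) h₁

theorem not_branch_ofWord {c : Fin k} {l : List (Fin k)} (h : (c :: l).IsChain (· ≠ ·)) :
    ¬ Branch c (ofWord l) := by
  have hl : word (ofWord l) = l := word_ofWord h.tail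
  rw [List.isChain_cons] at h
  intro hh
  rw [Branch, hl] at hh
  exact h.1 c hh rfl

theorem len_gen_mul_of_branch {c : Fin k} {x : ColourGroup k} (h : Branch c x) :
    len (gen c * x) + 1 = len x := by
  obtain ⟨l, hl⟩ := List.head?_eq_some_iff.1 h
  rw [← length_word, ← length_word, word_gen_mul_of_cons hl, hl]
  rfl

/-- A path from outside a branch into it passes through the neutral element. -/
theorem len_mul_le_of_branch_mul {c : Fin k} {w x : ColourGroup k} (hw : ¬ Branch c w)
    (h : Branch c (w * x)) : len (w * x) ≤ len x := by
  have key : ∀ l : List (Fin k), Branch c (w * ofWord l) → len (w * ofWord l) ≤ l.length := by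
    intro l
    induction l using List.reverseRecOn with
    | nil => intro hb; simp at hb; exact absurd hb hw
    | append_singleton l d ih =>
      rw [ofWord_concat, ← mul_assoc]
      intro hb
      by_cases hc : Branch c (w * ofWord l)
      · have := ih hc
        have := len_mul_gen_le (w * ofWord l) d
        simp; omega
      · rw [(eq_of_branch_mul_gen hc hb).1]
        simp
  simpa [length_word] using key (word x) (by simpa using h)

theorem finite_setOf_len_le (n : ℕ) : {x : ColourGroup k | len x ≤ n}.Finite := by
  refine ((List.finite_length_le (Fin k) n).image ofWord).subset ?_
  intro x hx
  exact ⟨word x, by simpa [length_word] using hx, ofWord_word x⟩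

end ColourGroup

/-! ### Multigraphs with loops, their universal covers, and outputs on them. -/

/-- A properly edge-coloured multigraph, given by its nodes, the colours that are present at each
node, and the node to which each colour leads. Loops of any colour are allowed; they unfold to
edges in the universal cover. -/
structure PortGraph (k : ℕ) (Q : Type*) where
  allowed : Q → Fin k → Prop
  next : Fin k → Q → Q
  next_next : ∀ c q, next c (next c q) = q
  allowed_next : ∀ c q, allowed q c → allowed (next c q) c

namespace PortGraph

open ColourGroup

variable {k : ℕ} {Q Q' : Type*}

/-- The word `l` is the sequence of colours of a walk that starts at the given node. -/
def Walk (P : PortGraph k Q) : Q → List (Fin k) → Prop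
  | _, [] => True
  | q, c :: l => P.allowed q c ∧ P.Walk (P.next c q) l

/-- The end of the walk with a given sequence of colours. -/
def run (P : PortGraph k Q) : Q → List (Fin k) → Q
  | q, [] => q
  | q, c :: l => P.run (P.next c q) l

variable (P : PortGraph k Q) (P' : PortGraph k Q')

theorem walk_concat (q : Q) (l : List (Fin k)) (c : Fin k) :
    P.Walk q (l ++ [c]) ↔ P.Walk q l ∧ P.allowed (P.run q l) c := by
  induction l generalizing q with
  | nil => simp [Walk, run]
  | cons d l ih => simp [Walk, run, ih, and_assoc]

theorem run_concat (q : Q) (l : List (Fin k)) (c : Fin k) :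
    P.run q (l ++ [c]) = P.next c (P.run q l) := by
  induction l generalizing q with
  | nil => simp [run]
  | cons d l ih => simp [run, ih]

/-- The universal cover with base point `q`, as a colour system. -/
def cover (q : Q) : ColourSystem k where
  carrier := {x | P.Walk q (word x)}
  nonempty := ⟨1, by simp [Walk]⟩
  pred_mem := by
    intro v hv c hc
    rcases word_mul_gen v c with h | h
    · have := congrArg List.length h
      simp [length_word] at this
      omega
    · simp only [Set.mem_ofPred_eq] at hv ⊢
      rw [h, walk_concat] at hv
      exact hv.1

theorem one_mem_cover (q : Q) : (1 : ColourGroup k) ∈ (P.cover q).carrier := by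
  simp [cover, Walk]

theorem mem_cover {q : Q} {x : ColourGroup k} : x ∈ (P.cover q).carrier ↔ P.Walk q (word x) :=
  Iff.rfl

theorem run_word_mul_gen (q : Q) (x : ColourGroup k) (c : Fin k) :
    P.run q (word (x * gen c)) = P.next c (P.run q (word x)) := by
  rcases word_mul_gen x c with h | h
  · rw [h, run_concat]
  · rw [h, run_concat, next_next]

/-- If the last letter cancels, the step goes back along the edge just used, and `allowed_next`
makes that colour present at its far end too. -/
theorem mul_gen_mem_cover {q : Q} {x : ColourGroup k} (hx : x ∈ (P.cover q).carrier)
    (c : Fin k) : x * gen c ∈ (P.cover q).carrier ↔ P.allowed (P.run q (word x)) c := by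
  rw [mem_cover] at *
  rcases word_mul_gen x c with h | h
  · rw [h, walk_concat]
    simp [hx]
  · rw [h, walk_concat] at hx
    simp only [hx.1, true_iff]
    rw [h, run_concat]
    exact P.allowed_next _ _ hx.2

theorem run_word_gen_mul (q : Q) (x : ColourGroup k) (c : Fin k) :
    P.run q (word (gen c * x)) = P.run (P.next c q) (word x) := by
  by_cases h : (word x).head? = some c
  · obtain ⟨l, hl⟩ := List.head?_eq_some_iff.1 h
    rw [word_gen_mul_of_cons hl, hl]
    simp [run, next_next]
  · rw [word_gen_mul_of_head?_ne h]
    simp [run]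

/-- Moving the base point of a cover along an edge is left multiplication by a generator; this makes
`out` consistent between neighbours. -/
theorem gen_mul_mem_cover {q : Q} {c : Fin k} (hc : P.allowed q c) (x : ColourGroup k) :
    gen c * x ∈ (P.cover q).carrier ↔ x ∈ (P.cover (P.next c q)).carrier := by
  simp only [mem_cover]
  by_cases h : (word x).head? = some c
  · obtain ⟨l, hl⟩ := List.head?_eq_some_iff.1 h
    rw [word_gen_mul_of_cons hl, hl]
    simp [Walk, next_next, P.allowed_next c q hc]
  · rw [word_gen_mul_of_head?_ne h]
    simp [Walk, hc]

/-- Two nodes have the same neighbourhood of radius `n` in the universal covers. -/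
def Agree : ℕ → Q → Q' → Prop
  | 0, _, _ => True
  | n + 1, q, q' => ∀ c, (P.allowed q c ↔ P'.allowed q' c) ∧
      (P.allowed q c → Agree n (P.next c q) (P'.next c q'))

variable {P P'}

theorem Agree.walk_iff {n : ℕ} {q : Q} {q' : Q'} (h : Agree P P' n q q') (l : List (Fin k))
    (hl : l.length ≤ n) : P.Walk q l ↔ P'.Walk q' l := by
  induction l generalizing q q' n with
  | nil => simp [Walk]
  | cons c l ih =>
    cases n with
    | zero => simp at hl
    | succ n =>
      have h2 := h c
      simp only [Walk, ← h2.1]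
      exact and_congr_right fun hc => ih (h2.2 hc) (by simpa using hl)

variable (A : LocalOutput k)

/-- The output of a local algorithm at a node of the universal cover above `q`. -/
def out (P : PortGraph k Q) (q : Q) : Option (Fin k) :=
  A (P.cover q) ⟨1, P.one_mem_cover q⟩

variable {A} {r : ℕ}

theorem out_eq_of_agree (hA : A.HasRunningTime r) {q : Q} {q' : Q'}
    (h : Agree P P' (r + 1) q q') : P.out A q = P'.out A q' := by
  apply hA
  ext x
  simp only [ColourSystem.view, one_mul, Set.mem_ofPred_eq]
  apply and_congr_left
  intro hx
  exact h.walk_iff _ (by rwa [length_word])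

theorem out_next (hA : A.HasRunningTime r) {q : Q} {c : Fin k} (hc : P.allowed q c)
    (h : (1 : ColourGroup k) * gen c ∈ (P.cover q).carrier) :
    P.out A (P.next c q) = A (P.cover q) ⟨1 * gen c, h⟩ := by
  apply hA
  ext x
  simp only [ColourSystem.view, one_mul, Set.mem_ofPred_eq, P.gen_mul_mem_cover hc]

theorem one_mul_gen_mem_cover {q : Q} {c : Fin k} :
    (1 : ColourGroup k) * gen c ∈ (P.cover q).carrier ↔ P.allowed q c := by
  rw [mem_cover]
  simp [Walk]

theorem out_eq_some (hA : A.HasRunningTime r)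
    (hM : ∀ V : ColourSystem k, A.FindsMaximalMatching V) {q : Q} {c : Fin k}
    (h : P.out A q = some c) :
    P.allowed q c ∧ P.out A (P.next c q) = some c := by
  obtain ⟨h1, h2⟩ := (hM (P.cover q)).1 _ c h
  have hc := one_mul_gen_mem_cover.1 h1
  exact ⟨hc, (out_next hA hc h1).trans h2⟩

theorem out_next_ne_none (hA : A.HasRunningTime r)
    (hM : ∀ V : ColourSystem k, A.FindsMaximalMatching V) {q : Q} {c : Fin k}
    (hc : P.allowed q c) (h : P.out A q = none) :
    P.out A (P.next c q) ≠ none := by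
  have h1 : (1 : ColourGroup k) * gen c ∈ (P.cover q).carrier := one_mul_gen_mem_cover.2 hc
  rw [out_next hA hc h1]
  exact (hM (P.cover q)).2 _ c h1 h

end PortGraph

/-! ### Templates, their multigraphs, and two notions of agreement. -/

/-- A set of nodes of the Cayley graph of `G_k` and, for each of its nodes, a colour that is not
used by the edges inside the set. The remaining unused colours of a node are regarded as loops. -/
@[ext]
structure Template (k : ℕ) where
  carrier : Set (ColourGroup k)
  missing : ColourGroup k → Fin k
  missing_notMem : ∀ x ∈ carrier, x * ColourGroup.gen (missing x) ∉ carrier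

namespace Template

open ColourGroup PortGraph

variable {k : ℕ}

open Classical in
/-- The step along the edge of colour `c` if both ends are nodes, and along a loop otherwise. -/
noncomputable def step (T : Template k) (c : Fin k) (x : ColourGroup k) : ColourGroup k :=
  if x ∈ T.carrier ∧ x * gen c ∈ T.carrier then x * gen c else x

theorem step_of_mem {T : Template k} {c : Fin k} {x : ColourGroup k} (hx : x ∈ T.carrier)
    (h : x * gen c ∈ T.carrier) : T.step c x = x * gen c :=
  if_pos ⟨hx, h⟩

theorem step_of_notMem {T : Template k} {c : Fin k} {x : ColourGroup k}
    (h : x * gen c ∉ T.carrier) : T.step c x = x :=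
  if_neg fun h' => h h'.2

theorem step_congr {S T : Template k} {c : Fin k} {x : ColourGroup k}
    (hx : x ∈ S.carrier ↔ x ∈ T.carrier) (hc : x * gen c ∈ S.carrier ↔ x * gen c ∈ T.carrier) :
    S.step c x = T.step c x := by
  unfold step
  congr 1
  rw [hx, hc]

theorem step_step (T : Template k) (c : Fin k) (x : ColourGroup k) :
    T.step c (T.step c x) = x := by
  by_cases h : x ∈ T.carrier ∧ x * gen c ∈ T.carrier
  · rw [step_of_mem h.1 h.2, step_of_mem h.2 (by simpa using h.1), mul_gen_mul_gen]
  · have : T.step c x = x := if_neg h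
    rw [this, this]

theorem step_mem {T : Template k} {c : Fin k} {x : ColourGroup k} (hx : x ∈ T.carrier) :
    T.step c x ∈ T.carrier := by
  by_cases h : x * gen c ∈ T.carrier
  · rwa [step_of_mem hx h]
  · rwa [step_of_notMem h]

/-- The multigraph of a template, with loops for all colours that are neither used nor missing. -/
noncomputable def graph (T : Template k) : PortGraph k (ColourGroup k) where
  allowed x c := c ≠ T.missing x
  next := T.step
  next_next := T.step_step
  allowed_next := by
    intro c x hc
    by_cases h : x ∈ T.carrier ∧ x * gen c ∈ T.carrier
    · rw [step_of_mem h.1 h.2]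
      rintro hm
      apply T.missing_notMem _ h.2
      rw [← hm]
      simpa using h.1
    · have : T.step c x = x := if_neg h
      rwa [this]

/-- Each node has exactly `h` edges inside the template. -/
def Regular (T : Template k) (h : ℕ) : Prop :=
  ∀ x ∈ T.carrier, {c | x * gen c ∈ T.carrier}.ncard = h

/-- The colours of the loops at a node. -/
def free (T : Template k) (x : ColourGroup k) : Set (Fin k) :=
  {c | c ≠ T.missing x ∧ x * gen c ∉ T.carrier}

/-- The h edges and the missing colour account for at most h + 1 of the k colours. -/
theorem Regular.free_nonempty {T : Template k} {h : ℕ} (hT : T.Regular h) (hk : h + 1 < k)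
    {x : ColourGroup k} (hx : x ∈ T.carrier) : (T.free x).Nonempty := by
  by_contra hne
  have hu : (Set.univ : Set (Fin k)) ⊆ insert (T.missing x) {c | x * gen c ∈ T.carrier} := by
    intro c _
    by_contra hc
    simp only [Set.mem_insert_iff, Set.mem_ofPred_eq, not_or] at hc
    exact hne ⟨c, hc⟩
  have h1 := Set.ncard_le_ncard hu
  have h2 := Set.ncard_insert_le (T.missing x) {c | x * gen c ∈ T.carrier}
  rw [hT x hx] at h2
  rw [Set.ncard_univ, Nat.card_fin] at h1
  omega

/-- The templates agree in the ball of radius `h` about the neutral element. -/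
def AgreeTo (S T : Template k) (h : ℕ) : Prop :=
  (∀ x, len x ≤ h → (x ∈ S.carrier ↔ x ∈ T.carrier)) ∧
    ∀ x, len x < h → S.missing x = T.missing x

theorem AgreeTo.symm {S T : Template k} {h : ℕ} (hST : S.AgreeTo T h) : T.AgreeTo S h :=
  ⟨fun x hx => (hST.1 x hx).symm, fun x hx => (hST.2 x hx).symm⟩

theorem AgreeTo.step_eq {S T : Template k} {h : ℕ} (hST : S.AgreeTo T h) {x : ColourGroup k}
    (hx : len x < h) (c : Fin k) : S.step c x = T.step c x := by
  have := len_mul_gen_le x c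
  exact step_congr (hST.1 x hx.le) (hST.1 (x * gen c) (by omega))

theorem len_step_le (T : Template k) (c : Fin k) (x : ColourGroup k) :
    len (T.step c x) ≤ len x + 1 := by
  unfold step
  split_ifs
  · exact len_mul_gen_le x c
  · omega

/-- A view of radius n tests missing colours only at the first n nodes of a walk, which explains the
strict inequality for `missing` in `AgreeTo`. -/
theorem AgreeTo.agree {S T : Template k} {h : ℕ} (hST : S.AgreeTo T h) {n : ℕ}
    {x : ColourGroup k} (hx : len x + n ≤ h) : Agree S.graph T.graph n x x := by
  induction n generalizing x with
  | zero => trivial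
  | succ n ih =>
    intro c
    refine ⟨?_, fun _ => ?_⟩
    · simp only [graph, hST.2 x (by omega)]
    · change Agree S.graph T.graph n (S.step c x) (T.step c x)
      rw [← hST.step_eq (by omega)]
      have := S.len_step_le c x
      exact ih (by omega)

/-- The templates agree outside the branch `c`. -/
def AgreeOff (c : Fin k) (S T : Template k) : Prop :=
  ∀ x, ¬ Branch c x → (x ∈ S.carrier ↔ x ∈ T.carrier) ∧ S.missing x = T.missing x

/-- The branch can be entered only from the neutral element, and a walk from `x` needs at least `len
x` steps to get there, so n ≤ `len x` leaves no step for crossing. -/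
theorem AgreeOff.agree {S T : Template k} {c : Fin k} (hST : AgreeOff c S T) {n : ℕ}
    {x : ColourGroup k} (hx : ¬ Branch c x) (hn : n ≤ len x) :
    Agree S.graph T.graph n x x := by
  induction n generalizing x with
  | zero => trivial
  | succ n ih =>
    intro d
    refine ⟨?_, fun _ => ?_⟩
    · simp only [graph, (hST x hx).2]
    · have hd : ¬ Branch c (x * gen d) := by
        intro hb
        rw [(eq_of_branch_mul_gen hx hb).1] at hn
        simp at hn
      change Agree S.graph T.graph n (S.step d x) (T.step d x)
      have hs : S.step d x = T.step d x := step_congr (hST x hx).1 (hST _ hd).1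
      rw [← hs, step]
      split_ifs
      · have := len_le_len_mul_gen x d
        exact ih hd (by omega)
      · exact ih hx (by omega)

/-- Change of the base point. -/
def translate (w : ColourGroup k) (T : Template k) : Template k where
  carrier := {x | w * x ∈ T.carrier}
  missing x := T.missing (w * x)
  missing_notMem := by
    intro x hx
    rw [Set.mem_ofPred_eq, ← mul_assoc]
    exact T.missing_notMem _ hx

theorem mem_translate {w x : ColourGroup k} {T : Template k} :
    x ∈ (translate w T).carrier ↔ w * x ∈ T.carrier := Iff.rfl

theorem mul_step_translate (w x : ColourGroup k) (T : Template k) (c : Fin k) :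
    w * (translate w T).step c x = T.step c (w * x) := by
  by_cases h : w * x ∈ T.carrier ∧ w * x * gen c ∈ T.carrier
  · rw [step_of_mem h.1 h.2, step_of_mem (mem_translate.2 h.1), mul_assoc]
    rw [mem_translate, ← mul_assoc]
    exact h.2
  · have h1 : T.step c (w * x) = w * x := if_neg h
    have h2 : (translate w T).step c x = x := by
      refine if_neg fun h' => h ⟨h'.1, ?_⟩
      rw [mul_assoc]
      exact h'.2
    rw [h1, h2]

theorem agree_translate (w x : ColourGroup k) (T : Template k) (n : ℕ) :
    Agree (translate w T).graph T.graph n x (w * x) := by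
  induction n generalizing x with
  | zero => trivial
  | succ n ih =>
    intro c
    refine ⟨Iff.rfl, fun _ => ?_⟩
    change Agree (translate w T).graph T.graph n ((translate w T).step c x) (T.step c (w * x))
    rw [← mul_step_translate]
    exact ih _

theorem Regular.translate {T : Template k} {h : ℕ} (hT : T.Regular h) (w : ColourGroup k) :
    (translate w T).Regular h := by
  intro x hx
  simp only [mem_translate, ← mul_assoc]
  exact hT _ hx

/-! ### Outputs of an algorithm -/

variable {A : LocalOutput k} {r : ℕ}

variable (A) in
/-- The node is matched along an edge of the template. -/
def Internal (T : Template k) (x : ColourGroup k) : Prop :=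
  ∃ c, T.graph.out A x = some c ∧ x * gen c ∈ T.carrier

theorem out_translate (hA : A.HasRunningTime r) (w x : ColourGroup k) (T : Template k) :
    (translate w T).graph.out A x = T.graph.out A (w * x) :=
  out_eq_of_agree hA (agree_translate w x T _)

theorem internal_translate (hA : A.HasRunningTime r) (w x : ColourGroup k) (T : Template k) :
    (translate w T).Internal A x ↔ T.Internal A (w * x) := by
  simp only [Internal, out_translate hA, mem_translate, mul_assoc]

theorem out_mul_gen (hA : A.HasRunningTime r)
    (hM : ∀ V : ColourSystem k, A.FindsMaximalMatching V) {T : Template k} {x : ColourGroup k}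
    {c : Fin k} (hx : x ∈ T.carrier) (hc : x * gen c ∈ T.carrier) :
    T.graph.out A (x * gen c) = some c ↔ T.graph.out A x = some c := by
  have hs : T.graph.next c x = x * gen c := step_of_mem hx hc
  constructor
  · intro h
    have := (out_eq_some hA hM h).2
    rwa [← hs, next_next] at this
  · intro h
    rw [← hs]
    exact (out_eq_some hA hM h).2

/-- A loop makes the node its own neighbour, so being unmatched would violate maximality on an edge
of the cover. -/
theorem out_ne_none (hA : A.HasRunningTime r)
    (hM : ∀ V : ColourSystem k, A.FindsMaximalMatching V) {T : Template k} {x : ColourGroup k}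
    (hx : (T.free x).Nonempty) : T.graph.out A x ≠ none := by
  obtain ⟨c, hc, hcx⟩ := hx
  intro h
  have hs : T.graph.next c x = x := step_of_notMem hcx
  have := out_next_ne_none hA hM (P := T.graph) (q := x) (c := c) hc h
  rw [hs] at this
  exact this h

/-- If two templates agree outside a branch and the edge that leads to the branch is matched in only
one of them, then some node outside the branch is matched internally in only one of them: otherwise
the symmetric difference of the two matchings contains an infinite path. -/
theorem exists_internal_ne (hA : A.HasRunningTime r)
    (hM : ∀ V : ColourSystem k, A.FindsMaximalMatching V) {X Y : Template k} {c : Fin k}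
    (hXY : AgreeOff c X Y) (h1 : 1 ∈ X.carrier) (hcX : gen c ∈ X.carrier)
    (hcY : gen c ∈ Y.carrier)
    (hne : ¬ (X.graph.out A 1 = some c ↔ Y.graph.out A 1 = some c)) :
    ∃ w ∈ X.carrier, ¬ Branch c w ∧ ¬ (X.Internal A w ↔ Y.Internal A w) := by
  by_contra hcon
  push Not at hcon
  have hstep : ∀ {X Y : Template k} {w : ColourGroup k} {d : Fin k},
      (X.Internal A w ↔ Y.Internal A w) → w * gen d ∈ X.carrier →
      X.graph.out A w = some d → Y.graph.out A w ≠ some d →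
      ∃ d', d' ≠ d ∧ w * gen d' ∈ Y.carrier ∧ Y.graph.out A w = some d' ∧
        X.graph.out A w ≠ some d' := by
    intro X Y w d hI hd hX hY
    obtain ⟨d', hd', hw⟩ := hI.1 ⟨d, hX, hd⟩
    have hdd : d' ≠ d := by rintro rfl; exact hY hd'
    refine ⟨d', hdd, hw, hd', ?_⟩
    rw [hX]
    simpa using hdd.symm
  -- The alternating path: `l` leads away from the branch, and `d` is the colour of its last edge
  -- (`c` at the start), which is matched in exactly one of the two templates. Equal internal status
  -- at the end of `l` yields another such edge, of a colour other than `d`, so the path never turns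
  -- back.
  have key : ∀ n, ∃ (l : List (Fin k)) (d : Fin k), l.length = n ∧
      (c :: l).IsChain (· ≠ ·) ∧ (c :: l).getLast? = some d ∧ ofWord l ∈ X.carrier ∧
      ofWord l * gen d ∈ X.carrier ∧ ofWord l * gen d ∈ Y.carrier ∧
      ¬ (X.graph.out A (ofWord l) = some d ↔ Y.graph.out A (ofWord l) = some d) := by
    intro n
    induction n with
    | zero => exact ⟨[], c, rfl, List.isChain_singleton c, rfl, h1, by simpa, by simpa, hne⟩
    | succ n ih =>
      obtain ⟨l, d, hl, hch, hlast, hw, hdX, hdY, hx⟩ := ih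
      have hb := not_branch_ofWord hch
      have hwY := ((hXY _ hb).1).1 hw
      have hI := hcon _ hw hb
      have hd' : ∃ d', d' ≠ d ∧ (ofWord l * gen d' ∈ X.carrier ∨ ofWord l * gen d' ∈ Y.carrier) ∧
          ¬ (X.graph.out A (ofWord l) = some d' ↔ Y.graph.out A (ofWord l) = some d') := by
        by_cases hXd : X.graph.out A (ofWord l) = some d
        · obtain ⟨d', h1, h2, h3, h4⟩ := hstep hI hdX hXd (by tauto)
          exact ⟨d', h1, Or.inr h2, by tauto⟩
        · obtain ⟨d', h1, h2, h3, h4⟩ := hstep hI.symm hdY (by tauto) hXd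
          exact ⟨d', h1, Or.inl h2, by tauto⟩
      obtain ⟨d', hdd, hmem, hx'⟩ := hd'
      have hch' : (c :: (l ++ [d'])).IsChain (· ≠ ·) := by
        rw [← List.cons_append, List.isChain_append]
        refine ⟨hch, List.isChain_singleton d', ?_⟩
        intro y hy z hz
        rw [hlast] at hy
        simp only [Option.mem_def, Option.some.injEq, List.head?_cons] at hy hz
        rw [← hy, ← hz]
        exact hdd.symm
      have hb' := not_branch_ofWord hch'
      rw [ofWord_concat] at hb'
      have hX' : ofWord l * gen d' ∈ X.carrier := hmem.elim id fun h => ((hXY _ hb').1).2 h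
      have hY' : ofWord l * gen d' ∈ Y.carrier := ((hXY _ hb').1).1 hX'
      refine ⟨l ++ [d'], d', by simp [hl], hch', by rw [← List.cons_append, List.getLast?_concat], ?_⟩
      rw [ofWord_concat, mul_gen_mul_gen, out_mul_gen hA hM hw hX', out_mul_gen hA hM hwY hY']
      exact ⟨hX', hw, hwY, hx'⟩
  -- At distance r + 1 from the neutral element the algorithm cannot see into the branch, so it
  -- gives equal outputs in both templates.
  obtain ⟨l, d, hl, hch, -, -, -, -, hx⟩ := key (r + 1)
  have hlen : len (ofWord l) = r + 1 := by
    have hword : word (ofWord l) = l := word_ofWord hch.tail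
    rw [← length_word, hword, hl]
  rw [out_eq_of_agree hA (hXY.agree (not_branch_ofWord hch) hlen.ge)] at hx
  exact hx Iff.rfl

variable (A) in
/-- Two regular templates that agree up to distance `h` from the neutral element, which is matched
internally in only one of them. -/
structure Critical (h : ℕ) (S T : Template k) : Prop where
  regular_left : S.Regular h
  regular_right : T.Regular h
  one_mem_left : 1 ∈ S.carrier
  one_mem_right : 1 ∈ T.carrier
  agreeTo : S.AgreeTo T h
  internal_left : S.Internal A 1
  not_internal_right : ¬ T.Internal A 1

/-- The node where the internal status differs becomes the new root. Agreement to radius h survives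
the move: a point of the branch is no farther from the old root than from the new one, because the
path to it passes through the old root. -/
theorem exists_critical_of_agreeOff (hA : A.HasRunningTime r)
    (hM : ∀ V : ColourSystem k, A.FindsMaximalMatching V) {X Y : Template k} {c : Fin k} {h : ℕ}
    (hX : X.Regular h) (hY : Y.Regular h) (hXY : AgreeOff c X Y) (hh : X.AgreeTo Y h)
    (h1 : 1 ∈ X.carrier) (hcX : gen c ∈ X.carrier) (hcY : gen c ∈ Y.carrier)
    (hne : ¬ (X.graph.out A 1 = some c ↔ Y.graph.out A 1 = some c)) :
    ∃ S T, Critical A h S T := by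
  obtain ⟨w, hw, hb, hI⟩ := exists_internal_ne hA hM hXY h1 hcX hcY hne
  have hwY := ((hXY w hb).1).1 hw
  have hag : (translate w X).AgreeTo (translate w Y) h := by
    constructor
    · intro x hx
      simp only [mem_translate]
      by_cases hbx : Branch c (w * x)
      · exact hh.1 _ ((len_mul_le_of_branch_mul hb hbx).trans hx)
      · exact (hXY _ hbx).1
    · intro x hx
      by_cases hbx : Branch c (w * x)
      · exact hh.2 _ ((len_mul_le_of_branch_mul hb hbx).trans_lt hx)
      · exact (hXY _ hbx).2
  have e1 := internal_translate hA w 1 X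
  have e2 := internal_translate hA w 1 Y
  rw [mul_one] at e1 e2
  by_cases hXw : X.Internal A w
  · exact ⟨translate w X, translate w Y, hX.translate w, hY.translate w, by simpa [mem_translate],
      by simpa [mem_translate], hag, e1.2 hXw, by tauto⟩
  · exact ⟨translate w Y, translate w X, hY.translate w, hX.translate w, by simpa [mem_translate],
      by simpa [mem_translate], hag.symm, by tauto, by tauto⟩

/-! ### Grafting -/

/-- The edge of colour `c` at the neutral element belongs to the template. -/
def HasRootEdge (T : Template k) (c : Fin k) : Prop :=
  1 ∈ T.carrier ∧ gen c ∈ T.carrier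

variable {c : Fin k} {K L : Template k}

open Classical in
/-- The nodes of `K` outside the branch `c` and those of `L` in this branch. -/
def graftCarrier (c : Fin k) (K L : Template k) : Set (ColourGroup k) :=
  {x | if Branch c x then x ∈ L.carrier else x ∈ K.carrier}

theorem mem_graftCarrier_of_branch {x : ColourGroup k} (h : Branch c x) :
    x ∈ graftCarrier c K L ↔ x ∈ L.carrier := by
  simp [graftCarrier, h]

theorem mem_graftCarrier_of_not_branch {x : ColourGroup k} (h : ¬ Branch c x) :
    x ∈ graftCarrier c K L ↔ x ∈ K.carrier := by
  simp [graftCarrier, h]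

theorem mul_gen_mem_graftCarrier_of_branch (hK : K.HasRootEdge c) (hL : L.HasRootEdge c)
    {x : ColourGroup k} (h : Branch c x) (d : Fin k) :
    x * gen d ∈ graftCarrier c K L ↔ x * gen d ∈ L.carrier := by
  by_cases hd : Branch c (x * gen d)
  · exact mem_graftCarrier_of_branch hd
  · have h1 := (eq_of_branch_mul_gen hd (d := d) (by simpa using h)).1
    rw [mem_graftCarrier_of_not_branch hd, h1]
    exact iff_of_true hK.1 hL.1

theorem mul_gen_mem_graftCarrier_of_not_branch (hK : K.HasRootEdge c) (hL : L.HasRootEdge c)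
    {x : ColourGroup k} (h : ¬ Branch c x) (d : Fin k) :
    x * gen d ∈ graftCarrier c K L ↔ x * gen d ∈ K.carrier := by
  by_cases hd : Branch c (x * gen d)
  · obtain ⟨rfl, rfl⟩ := eq_of_branch_mul_gen h hd
    rw [mem_graftCarrier_of_branch hd, one_mul]
    exact iff_of_true hL.2 hK.2
  · exact mem_graftCarrier_of_not_branch hd

open Classical in
/-- The template that is obtained from `K` by replacing the branch `c` by that of `L`. -/
noncomputable def graft (c : Fin k) (K L : Template k) (hK : K.HasRootEdge c)
    (hL : L.HasRootEdge c) : Template k where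
  carrier := graftCarrier c K L
  missing x := if Branch c x then L.missing x else K.missing x
  missing_notMem := by
    intro x hx
    by_cases h : Branch c x
    · rw [if_pos h, mul_gen_mem_graftCarrier_of_branch hK hL h]
      exact L.missing_notMem x ((mem_graftCarrier_of_branch h).1 hx)
    · rw [if_neg h, mul_gen_mem_graftCarrier_of_not_branch hK hL h]
      exact K.missing_notMem x ((mem_graftCarrier_of_not_branch h).1 hx)

variable {hK : K.HasRootEdge c} {hL : L.HasRootEdge c} {h : ℕ}

theorem hasRootEdge_graft : (graft c K L hK hL).HasRootEdge c :=
  ⟨(mem_graftCarrier_of_not_branch (not_branch_one c)).2 hK.1,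
    (mem_graftCarrier_of_branch (branch_gen c)).2 hL.2⟩

theorem Regular.graft (hrK : K.Regular h) (hrL : L.Regular h) :
    (graft c K L hK hL).Regular h := by
  intro x hx
  change {d | x * gen d ∈ graftCarrier c K L}.ncard = h
  change x ∈ graftCarrier c K L at hx
  by_cases hb : Branch c x
  · simp only [mul_gen_mem_graftCarrier_of_branch hK hL hb]
    exact hrL x ((mem_graftCarrier_of_branch hb).1 hx)
  · simp only [mul_gen_mem_graftCarrier_of_not_branch hK hL hb]
    exact hrK x ((mem_graftCarrier_of_not_branch hb).1 hx)

theorem agreeOff_graft : AgreeOff c (graft c K L hK hL) K :=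
  fun _ hx => ⟨mem_graftCarrier_of_not_branch hx, if_neg hx⟩

/-- The template is invariant under the translation by the generator of colour `c`. -/
def Invariant (T : Template k) (c : Fin k) : Prop :=
  ∀ x, (gen c * x ∈ T.carrier ↔ x ∈ T.carrier) ∧ T.missing (gen c * x) = T.missing x

/-- Translation by `gen c` exchanges the branch with its complement, and by invariance each half is
mapped to the matching half of the same template. -/
theorem translate_graft (hiK : K.Invariant c) (hiL : L.Invariant c) :
    translate (gen c) (graft c K L hK hL) = graft c L K hL hK := by
  ext x
  · change gen c * x ∈ graftCarrier c K L ↔ x ∈ graftCarrier c L K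
    by_cases hb : Branch c x
    · rw [mem_graftCarrier_of_branch hb, mem_graftCarrier_of_not_branch (by simpa using hb),
        (hiK x).1]
    · rw [mem_graftCarrier_of_not_branch hb, mem_graftCarrier_of_branch (by simpa using hb),
        (hiL x).1]
  · by_cases hb : Branch c x <;> simp [translate, graft, hb, (hiK x).2, (hiL x).2]

/-- The radius grows by one: the graft differs from `K` only inside the branch, and there invariance
moves a point to `gen c * x`, one step closer to the root, before `K` and `L` are compared. -/
theorem agreeTo_graft (hiK : K.Invariant c) (hiL : L.Invariant c) (hKL : K.AgreeTo L h) :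
    (graft c K L hK hL).AgreeTo K (h + 1) := by
  constructor
  · intro x hx
    by_cases hb : Branch c x
    · have := len_gen_mul_of_branch hb
      refine (mem_graftCarrier_of_branch hb).trans ?_
      rw [← (hiL x).1, ← (hiK x).1, hKL.1 _ (by omega)]
    · exact mem_graftCarrier_of_not_branch hb
  · intro x hx
    by_cases hb : Branch c x
    · have := len_gen_mul_of_branch hb
      refine (if_pos hb).trans ?_
      rw [← (hiL x).2, ← (hiK x).2, hKL.2 _ (by omega)]
    · exact if_neg hb

theorem exists_critical_of_graft (hA : A.HasRunningTime r)
    (hM : ∀ V : ColourSystem k, A.FindsMaximalMatching V) (hrK : K.Regular h) (hrL : L.Regular h)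
    (hiK : K.Invariant c) (hiL : L.Invariant c) (hK : K.HasRootEdge c) (hL : L.HasRootEdge c)
    {n : ℕ} (hn : n + 1 = h) (hKL : K.AgreeTo L n) (hoK : K.graph.out A 1 = some c)
    (hoL : L.graph.out A 1 ≠ some c) : ∃ S T, Critical A h S T := by
  subst hn
  -- If the root edge of the graft is matched, the graft is compared with `L`, otherwise with `K`.
  -- The first comparison views the edge from its other end, where the root lies on the side of `L`.
  by_cases hX : (graft c K L hK hL).graph.out A 1 = some c
  · have hroot : (graft c K L hK hL).HasRootEdge c := hasRootEdge_graft
    have hX' : (graft c L K hL hK).graph.out A 1 = some c := by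
      rw [← translate_graft hiK hiL, out_translate hA, mul_one, ← one_mul (gen c),
        out_mul_gen hA hM hroot.1 (by simpa using hroot.2), hX]
    exact exists_critical_of_agreeOff hA hM (hrL.graft hrK) hrL agreeOff_graft
      (agreeTo_graft hiL hiK hKL.symm) hasRootEdge_graft.1 hasRootEdge_graft.2 hL.2 (by tauto)
  · exact exists_critical_of_agreeOff hA hM (hrK.graft hrL) hrK agreeOff_graft
      (agreeTo_graft hiK hiL hKL) hasRootEdge_graft.1 hasRootEdge_graft.2 hK.2 (by tauto)

end Template

namespace Template

open ColourGroup PortGraph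

variable {k : ℕ}

/-! ### Unfolding one loop at each node -/

open Classical in
/-- A member of the set `F`, namely `c` if possible. -/
noncomputable def pick (c : Fin k) (F : Set (Fin k)) : Fin k :=
  -- The final `c` is a default; `unfold` requires a free colour at every node of its template.
  if c ∈ F then c else if h : F.Nonempty then h.some else c

theorem pick_mem (c : Fin k) {F : Set (Fin k)} (h : F.Nonempty) : pick c F ∈ F := by
  unfold pick
  split_ifs with hc
  · exact hc
  · exact h.some_mem

theorem pick_of_mem {c : Fin k} {F : Set (Fin k)} (h : c ∈ F) : pick c F = c :=
  if_pos h

/-- The multigraph with the edges of the template and one loop at each node, of colour `c`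
wherever possible. -/
noncomputable def loopGraph (c : Fin k) (T : Template k) : PortGraph k (ColourGroup k) where
  allowed x d := x * gen d ∈ T.carrier ∨ d = pick c (T.free x)
  next := T.step
  next_next := T.step_step
  allowed_next := by
    intro d x hd
    by_cases h : x ∈ T.carrier ∧ x * gen d ∈ T.carrier
    · rw [step_of_mem h.1 h.2, mul_gen_mul_gen]
      exact Or.inl h.1
    · have : T.step d x = x := if_neg h
      rwa [this]

/-- The node of the template that is covered by `x`. -/
noncomputable def pos (T : Template k) (x : ColourGroup k) : ColourGroup k :=
  T.graph.run 1 (word x)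

theorem loopGraph_run (c : Fin k) (T : Template k) (x : ColourGroup k) (l : List (Fin k)) :
    (loopGraph c T).run x l = T.graph.run x l := by
  induction l generalizing x with
  | nil => rfl
  | cons d l ih => exact ih _

theorem run_mem {T : Template k} {x : ColourGroup k} (hx : x ∈ T.carrier) (l : List (Fin k)) :
    T.graph.run x l ∈ T.carrier := by
  induction l generalizing x with
  | nil => exact hx
  | cons d l ih => exact ih (step_mem hx)

theorem pos_mem {T : Template k} (h1 : 1 ∈ T.carrier) (x : ColourGroup k) :
    T.pos x ∈ T.carrier :=
  run_mem h1 _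

theorem pos_one (T : Template k) : T.pos 1 = 1 := by
  simp [pos, run]

theorem pos_mul_gen (T : Template k) (x : ColourGroup k) (d : Fin k) :
    T.pos (x * gen d) = T.step d (T.pos x) :=
  T.graph.run_word_mul_gen 1 x d

theorem pos_gen_mul {T : Template k} {c : Fin k} (hc : gen c ∉ T.carrier) (x : ColourGroup k) :
    T.pos (gen c * x) = T.pos x := by
  have : T.graph.next c 1 = 1 := step_of_notMem (by simpa using hc)
  unfold pos
  rw [run_word_gen_mul, this]

theorem mul_gen_mem_cover_loopGraph {c : Fin k} {T : Template k} {x : ColourGroup k}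
    (hx : x ∈ ((loopGraph c T).cover 1).carrier) (d : Fin k) :
    x * gen d ∈ ((loopGraph c T).cover 1).carrier ↔
      T.pos x * gen d ∈ T.carrier ∨ d = pick c (T.free (T.pos x)) := by
  rw [mul_gen_mem_cover _ hx, loopGraph_run]
  rfl

/-- The universal cover of the template in which one loop at each node is unfolded. -/
noncomputable def unfold (c : Fin k) (T : Template k) (h1 : 1 ∈ T.carrier)
    (hF : ∀ x ∈ T.carrier, (T.free x).Nonempty) : Template k where
  carrier := ((loopGraph c T).cover 1).carrier
  missing x := T.missing (T.pos x)
  missing_notMem := by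
    intro x hx
    rw [mul_gen_mem_cover_loopGraph hx]
    rintro (h | h)
    · exact T.missing_notMem _ (pos_mem h1 x) h
    · exact (pick_mem c (hF _ (pos_mem h1 x))).1 h.symm

variable {c : Fin k} {T : Template k} {h1 : 1 ∈ T.carrier}
  {hF : ∀ x ∈ T.carrier, (T.free x).Nonempty} {h : ℕ}

theorem one_mem_unfold : 1 ∈ (unfold c T h1 hF).carrier :=
  one_mem_cover _ _

theorem hasRootEdge_unfold (hc : c ∈ T.free 1) : (unfold c T h1 hF).HasRootEdge c := by
  refine ⟨one_mem_unfold, ?_⟩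
  have := (mul_gen_mem_cover_loopGraph (one_mem_unfold (c := c) (h1 := h1) (hF := hF)) c).2
    (Or.inr (by rw [pos_one, pick_of_mem hc]))
  rwa [one_mul] at this

/-- The unfolded loop at the root has colour `c`, so a walk that first takes this loop is back at
the root: `x` and `gen c * x` lie over the same node. -/
theorem invariant_unfold (hc : c ∈ T.free 1) : (unfold c T h1 hF).Invariant c := by
  have hc' : gen c ∉ T.carrier := by simpa using hc.2
  intro x
  constructor
  · have hs : (loopGraph c T).next c 1 = 1 := step_of_notMem hc.2
    have := (loopGraph c T).gen_mul_mem_cover (q := 1) (c := c)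
      (Or.inr (pick_of_mem hc).symm) x
    rwa [hs] at this
  · change T.missing (T.pos (gen c * x)) = T.missing (T.pos x)
    rw [pos_gen_mul hc']

theorem Regular.unfold (hT : T.Regular h) : (unfold c T h1 hF).Regular (h + 1) := by
  intro x hx
  have hp := pos_mem h1 x
  have : {d | x * gen d ∈ (Template.unfold c T h1 hF).carrier} =
      insert (pick c (T.free (T.pos x))) {d | T.pos x * gen d ∈ T.carrier} := by
    ext d
    exact (mul_gen_mem_cover_loopGraph hx d).trans or_comm
  rw [this, Set.ncard_insert_of_notMem, hT _ hp]
  exact (pick_mem c (hF _ hp)).2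

/-- `pos` is a covering map of multigraphs: an unfolded loop becomes an edge between two copies of a
node and all other loops stay loops, so the algorithm cannot notice the unfolding. -/
theorem agree_unfold {x : ColourGroup k} (hx : x ∈ (unfold c T h1 hF).carrier) (n : ℕ) :
    Agree (unfold c T h1 hF).graph T.graph n x (T.pos x) := by
  induction n generalizing x with
  | zero => trivial
  | succ n ih =>
    intro d
    refine ⟨Iff.rfl, fun _ => ?_⟩
    change Agree _ _ n ((unfold c T h1 hF).step d x) (T.step d (T.pos x))
    by_cases hd : x * gen d ∈ (unfold c T h1 hF).carrier
    · rw [step_of_mem hx hd, ← pos_mul_gen]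
      exact ih hd
    · have hd' : T.pos x * gen d ∉ T.carrier :=
        fun h' => hd ((mul_gen_mem_cover_loopGraph hx d).2 (Or.inl h'))
      rw [step_of_notMem hd, step_of_notMem hd']
      exact ih hx

variable {A : LocalOutput k} {r : ℕ}

theorem out_unfold (hA : A.HasRunningTime r) :
    (unfold c T h1 hF).graph.out A 1 = T.graph.out A 1 := by
  have := out_eq_of_agree hA (agree_unfold (c := c) (hF := hF) (one_mem_unfold (h1 := h1)) _)
  rwa [pos_one] at this

theorem AgreeTo.free_eq {S T : Template k} (hST : S.AgreeTo T h) {x : ColourGroup k}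
    (hx : len x < h) : S.free x = T.free x := by
  ext d
  have := len_mul_gen_le x d
  simp only [free, Set.mem_ofPred_eq, hST.2 x hx, hST.1 (x * gen d) (by omega)]

theorem AgreeTo.run_eq {S T : Template k} (hST : S.AgreeTo T h) {l : List (Fin k)}
    {x : ColourGroup k} (hx : len x + l.length ≤ h) :
    S.graph.run x l = T.graph.run x l ∧ len (S.graph.run x l) ≤ len x + l.length := by
  induction l generalizing x with
  | nil => exact ⟨rfl, le_rfl⟩
  | cons d l ih =>
    simp only [List.length_cons] at hx ⊢
    have h1 := S.len_step_le d x
    have h2 := ih (x := S.step d x) (by omega)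
    have h3 : S.graph.run x (d :: l) = S.graph.run (S.step d x) l := rfl
    have h4 : T.graph.run x (d :: l) = T.graph.run (T.step d x) l := rfl
    rw [h3, h4, ← hST.step_eq (by omega)]
    exact ⟨h2.1, by omega⟩

theorem AgreeTo.walk_iff {S T : Template k} (hST : S.AgreeTo T h) {l : List (Fin k)}
    {x : ColourGroup k} (hx : len x + l.length ≤ h) :
    (loopGraph c S).Walk x l ↔ (loopGraph c T).Walk x l := by
  induction l generalizing x with
  | nil => exact Iff.rfl
  | cons d l ih =>
    simp only [List.length_cons] at hx
    have h1 := S.len_step_le d x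
    have h2 := len_mul_gen_le x d
    have h3 := ih (x := S.step d x) (by omega)
    refine and_congr ?_ ?_
    · simp only [loopGraph, hST.1 (x * gen d) (by omega), hST.free_eq (x := x) (by omega)]
    · change (loopGraph c S).Walk (S.step d x) l ↔ (loopGraph c T).Walk (T.step d x) l
      rw [← hST.step_eq (by omega)]
      exact h3

theorem AgreeTo.unfold {S : Template k} {h1' : 1 ∈ S.carrier}
    {hF' : ∀ x ∈ S.carrier, (S.free x).Nonempty} (hTS : T.AgreeTo S h) :
    (unfold c T h1 hF).AgreeTo (unfold c S h1' hF') h := by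
  constructor
  · intro x hx
    exact hTS.walk_iff (x := 1) (l := word x) (by simpa [length_word] using hx)
  · intro x hx
    have := hTS.run_eq (x := 1) (l := word x) (by simpa [length_word] using hx.le)
    simp only [len_one, zero_add, length_word] at this
    change T.missing (T.pos x) = S.missing (S.pos x)
    unfold pos
    rw [← this.1]
    exact hTS.2 _ (by omega)

theorem Critical.exists_succ (hA : A.HasRunningTime r)
    (hM : ∀ V : ColourSystem k, A.FindsMaximalMatching V) {S T : Template k}
    (hST : Critical A h S T) (h0 : 0 < h) (hk : h + 1 < k) :
    ∃ S' T', Critical A (h + 1) S' T' := by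
  have hFS : ∀ x ∈ S.carrier, (S.free x).Nonempty :=
    fun x hx => hST.regular_left.free_nonempty hk hx
  have hFT : ∀ x ∈ T.carrier, (T.free x).Nonempty :=
    fun x hx => hST.regular_right.free_nonempty hk hx
  -- The root of `T` has a loop, hence is matched; not being internal, it is matched along a loop.
  -- Its colour is free in `S` as well, where the root is matched along a template edge instead.
  obtain ⟨c, hc⟩ := Option.ne_none_iff_exists'.1 (out_ne_none hA hM (hFT 1 hST.one_mem_right))
  have hcT : c ∈ T.free 1 :=
    ⟨(out_eq_some hA hM hc).1, fun h => hST.not_internal_right ⟨c, hc, h⟩⟩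
  have hcS : c ∈ S.free 1 := by
    rwa [hST.agreeTo.free_eq (by simpa using h0)]
  refine exists_critical_of_graft hA hM
    (hST.regular_right.unfold (c := c) (h1 := hST.one_mem_right) (hF := hFT))
    (hST.regular_left.unfold (c := c) (h1 := hST.one_mem_left) (hF := hFS))
    (invariant_unfold hcT) (invariant_unfold hcS) (hasRootEdge_unfold hcT)
    (hasRootEdge_unfold hcS) rfl hST.agreeTo.symm.unfold ?_ ?_
  · rw [out_unfold hA, hc]
  · rw [out_unfold hA]
    intro hS
    obtain ⟨d, hd, hd'⟩ := hST.internal_left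
    rw [hS] at hd
    obtain rfl : c = d := by simpa using hd
    exact hcS.2 hd'

/-! ### The base case -/

/-- A single node with loops of all colours but one. -/
def bouquet (a : Fin k) : PortGraph k Unit where
  allowed _ c := c ≠ a
  next _ q := q
  next_next _ _ := rfl
  allowed_next _ _ h := h

theorem exists_out_bouquet (hA : A.HasRunningTime r)
    (hM : ∀ V : ColourSystem k, A.FindsMaximalMatching V) (hk : 1 < k) (a : Fin k) :
    ∃ c, c ≠ a ∧ (bouquet a).out A () = some c := by
  have : Nontrivial (Fin k) := Fin.nontrivial_iff_two_le.2 hk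
  obtain ⟨b, hb⟩ := exists_ne a
  have hne : (bouquet a).out A () ≠ none := fun h =>
    out_next_ne_none hA hM (P := bouquet a) (q := ()) (c := b) hb h h
  obtain ⟨c, hc⟩ := Option.ne_none_iff_exists'.1 hne
  exact ⟨c, (out_eq_some hA hM hc).1, hc⟩

/-- The template with a single edge. -/
def edge (x : Fin k) (m : ColourGroup k → Fin k) (h1 : m 1 ≠ x) (hx : m (gen x) ≠ x) :
    Template k where
  carrier := {1, gen x}
  missing := m
  missing_notMem := by
    rintro y (rfl | rfl)
    · simp only [one_mul, Set.mem_insert_iff, Set.mem_singleton_iff, not_or]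
      exact ⟨gen_ne_one _, fun h => h1 (gen_injective h)⟩
    · simp only [Set.mem_insert_iff, Set.mem_singleton_iff, not_or]
      constructor
      · intro h
        exact hx (eq_of_gen_mul_gen_eq_one h).symm
      · intro h
        exact gen_ne_one _ (mul_eq_left.1 h)

variable {x : Fin k} {m : ColourGroup k → Fin k} {hm : m 1 ≠ x} {hm' : m (gen x) ≠ x}

theorem hasRootEdge_edge : (edge x m hm hm').HasRootEdge x :=
  ⟨Or.inl rfl, Or.inr rfl⟩

theorem gen_mem_edge {c : Fin k} : gen c ∈ (edge x m hm hm').carrier ↔ c = x := by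
  change gen c = 1 ∨ gen c = gen x ↔ _
  simp [gen_ne_one, gen_injective.eq_iff]

theorem regular_edge : (edge x m hm hm').Regular 1 := by
  have h : ∀ y ∈ (edge x m hm hm').carrier,
      {c | y * gen c ∈ (edge x m hm hm').carrier} = {x} := by
    intro y hy
    ext c
    rw [Set.mem_ofPred_eq, Set.mem_singleton_iff]
    rcases hy with rfl | rfl
    · rw [one_mul, gen_mem_edge]
    · constructor
      · rintro (h | h)
        · exact (eq_of_gen_mul_gen_eq_one h).symm
        · exact absurd (mul_eq_left.1 h) (gen_ne_one _)
      · rintro rfl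
        exact Or.inl (gen_mul_gen _)
  intro y hy
  rw [h y hy, Set.ncard_singleton]

theorem internal_edge_iff :
    (edge x m hm hm').Internal A 1 ↔ (edge x m hm hm').graph.out A 1 = some x := by
  constructor
  · rintro ⟨c, hc, hcx⟩
    rw [one_mul, gen_mem_edge] at hcx
    rw [hc, hcx]
  · intro h
    exact ⟨x, h, by rw [one_mul, gen_mem_edge]⟩

/-- With a constant missing colour all nodes have the same allowed colours, so edges and loops are
indistinguishable and everything collapses to one node. -/
theorem agree_bouquet {T : Template k} {a : Fin k} (hT : ∀ y, T.missing y = a) (n : ℕ)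
    (y : ColourGroup k) : Agree T.graph (bouquet a) n y () := by
  induction n generalizing y with
  | zero => trivial
  | succ n ih =>
    intro c
    exact ⟨by simp [graph, bouquet, hT], fun _ => ih _⟩

theorem agreeTo_edge {m₁ m₂ : ColourGroup k → Fin k} {h1 h1' h2 h2'} (h : m₁ 1 = m₂ 1) :
    (edge x m₁ h1 h1').AgreeTo (edge x m₂ h2 h2') 1 := by
  refine ⟨fun y _ => Iff.rfl, fun y hy => ?_⟩
  rw [eq_one_of_len_eq_zero (Nat.lt_one_iff.1 hy)]
  exact h

theorem critical_edge {m₁ m₂ : ColourGroup k → Fin k}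
    {h1 h1' h2 h2'} (h : m₁ 1 = m₂ 1) (ho : (edge x m₁ h1 h1').graph.out A 1 = some x)
    (ho' : (edge x m₂ h2 h2').graph.out A 1 ≠ some x) :
    Critical A 1 (edge x m₁ h1 h1') (edge x m₂ h2 h2') :=
  ⟨regular_edge, regular_edge, hasRootEdge_edge.1, hasRootEdge_edge.1, agreeTo_edge h,
    (internal_edge_iff).2 ho, fun hi => ho' ((internal_edge_iff).1 hi)⟩

-- The mixed edge of colour `x`, with missing colours `a` and `b` at its ends, interpolates between
-- the two constant edges, of which only that of `a` is matched along `x`. Its status therefore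
-- differs from one of them, and it shares with that one the missing colour at a suitable end.
open Classical in
theorem exists_critical_one_of_bouquet (hA : A.HasRunningTime r)
    (hM : ∀ V : ColourSystem k, A.FindsMaximalMatching V) {a b : Fin k} (ha : a ≠ x) (hb : b ≠ x)
    (hoa : (bouquet a).out A () = some x) (hob : (bouquet b).out A () ≠ some x) :
    ∃ S T, Critical A 1 S T := by
  have hg : ∀ y : ColourGroup k, gen x * y = 1 ↔ y = gen x := fun y => by
    rw [mul_eq_one_iff_inv_eq, inv_eq_of_mul_eq_one_left (gen_mul_gen _), eq_comm]
  let M : Template k := edge x (fun y => if y = 1 then a else b) (by simpa) (by simpa [gen_ne_one])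
  let M' : Template k := edge x (fun y => if gen x * y = 1 then a else b)
    (by simpa [gen_ne_one]) (by simpa [gen_mul_gen])
  have hMM : translate (gen x) M = M' := by
    ext y
    · change gen x * y = 1 ∨ gen x * y = gen x ↔ y = 1 ∨ y = gen x
      rw [hg, mul_eq_left, or_comm]
    · rfl
  by_cases h : M.graph.out A 1 = some x
  · have h' : M'.graph.out A 1 = some x := by
      rw [← hMM, out_translate hA, mul_one, ← one_mul (gen x),
        out_mul_gen hA hM hasRootEdge_edge.1 (by simpa using hasRootEdge_edge.2), h]
    refine ⟨_, edge x (fun _ => b) hb hb, critical_edge (by simp [gen_ne_one]) h' ?_⟩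
    rw [out_eq_of_agree hA (agree_bouquet (a := b) (fun _ => rfl) _ _)]
    exact hob
  · refine ⟨edge x (fun _ => a) ha ha, _, critical_edge (by simp) ?_ h⟩
    rw [out_eq_of_agree hA (agree_bouquet (a := a) (fun _ => rfl) _ _)]
    exact hoa

theorem exists_critical_one (hA : A.HasRunningTime r)
    (hM : ∀ V : ColourSystem k, A.FindsMaximalMatching V) (hk : 2 < k) :
    ∃ S T, Critical A 1 S T := by
  choose f hf hof using exists_out_bouquet hA hM (by omega : 1 < k)
  have key : ∀ a b, f a ≠ b → f b ≠ f a → ∃ S T, Critical A 1 S T := fun a b hab hba =>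
    exists_critical_one_of_bouquet hA hM (x := f a) (hf a).symm hab.symm (hof a)
      (by rw [hof b]; simpa using hba)
  let a : Fin k := ⟨0, by omega⟩
  -- A third colour is needed: with two colours, `f` would be forced to swap them, and no pair would
  -- satisfy the hypotheses of `key`.
  obtain ⟨d, hda, hdb⟩ : ∃ d, d ≠ a ∧ d ≠ f a := by
    by_contra! hcon
    have h1 : (Finset.univ : Finset (Fin k)) ⊆ {a, f a} := by
      intro d _
      have := hcon d
      simp only [Finset.mem_insert, Finset.mem_singleton]
      tauto
    have h2 := Finset.card_le_card h1
    have h3 := Finset.card_le_two (a := a) (b := f a)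
    rw [Finset.card_univ, Fintype.card_fin] at h2
    omega
  by_cases hd : f d = f a
  · by_cases hfa : f (f a) = a
    · exact key (f a) d (by rw [hfa]; exact hda.symm) (by rw [hd, hfa]; exact hf a)
    · exact key (f a) a hfa (fun h => hf (f a) h.symm)
  · exact key a d hdb.symm hd

theorem exists_critical (hA : A.HasRunningTime r)
    (hM : ∀ V : ColourSystem k, A.FindsMaximalMatching V) (hk : 2 < k) (h : ℕ) (hh : h + 1 < k) :
    ∃ S T, Critical A (h + 1) S T := by
  induction h with
  | zero => exact exists_critical_one hA hM hk
  | succ h ih =>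
    obtain ⟨S, T, hST⟩ := ih (by omega)
    exact hST.exists_succ hA hM (by omega) hh

/-- If h ≥ r + 1, both roots have the same view and output; as h ≥ 1, the templates also agree on
whether the matched edge at the root is internal. -/
theorem Critical.lt (hA : A.HasRunningTime r) {S T : Template k} (hST : Critical A h S T)
    (h0 : 0 < h) : h < r + 1 := by
  by_contra! hr
  obtain ⟨c, hc, hcS⟩ := hST.internal_left
  refine hST.not_internal_right ⟨c, ?_, (hST.agreeTo.1 _ ?_).1 hcS⟩
  · rw [← hc]
    exact (out_eq_of_agree hA (hST.agreeTo.agree (by simpa using hr))).symm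
  · simpa using Nat.succ_le_of_lt h0

end Template

/-! ### Zero rounds, and the bound for local outputs. -/

namespace PortGraph

variable {k : ℕ} {A : LocalOutput k} {r : ℕ}

/-- The star with one edge of each colour, with centre `none`. -/
def star (k : ℕ) : PortGraph k (Option (Fin k)) where
  allowed q c := ∀ d ∈ q, c = d
  next c q := if q = none then some c else if q = some c then none else q
  next_next c q := by
    cases q with
    | none => simp
    | some d => by_cases h : d = c <;> simp [h]
  allowed_next c q h := by
    cases q with
    | none => simp
    | some d =>
      obtain rfl := h d rfl
      simp

/-- A single node with a loop of one colour. -/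
def loop (c : Fin k) : PortGraph k Unit where
  allowed _ d := d = c
  next _ q := q
  next_next _ _ := rfl
  allowed_next _ _ h := h

/-- With r = 0 a node sees only its own colours. A leaf of colour `c` looks like a single loop of
colour `c`, so it must be matched; then the centre of a star would be matched along every colour. -/
theorem pos_of_hasRunningTime (hA : A.HasRunningTime r)
    (hM : ∀ V : ColourSystem k, A.FindsMaximalMatching V) (hk : 1 < k) : 0 < r := by
  by_contra! hr
  obtain rfl : r = 0 := by omega
  have h1 : ∀ c, (loop c).out A () = some c := by
    intro c
    have hne : (loop c).out A () ≠ none := fun h =>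
      out_next_ne_none hA hM (P := loop c) (q := ()) (c := c) rfl h h
    obtain ⟨d, hd⟩ := Option.ne_none_iff_exists'.1 hne
    obtain rfl : d = c := (out_eq_some hA hM hd).1
    exact hd
  have h2 : ∀ c : Fin k, (star k).out A (some c) = some c := by
    intro c
    refine (out_eq_of_agree hA fun d => ⟨?_, fun _ => trivial⟩).trans (h1 c)
    simp [star, loop]
  have h3 : ∀ c : Fin k, (star k).out A none = some c := by
    intro c
    simpa [star] using (out_eq_some hA hM (h2 c)).2
  have h4 := (h3 ⟨0, by omega⟩).symm.trans (h3 ⟨1, hk⟩)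
  simp at h4

end PortGraph

theorem LocalOutput.le_of_findsMaximalMatching {k : ℕ} {A : LocalOutput k} {r : ℕ}
    (hA : A.HasRunningTime r) (hM : ∀ V : ColourSystem k, A.FindsMaximalMatching V) :
    k - 1 ≤ r := by
  rcases lt_or_ge 2 k with hk | hk
  · obtain ⟨S, T, hST⟩ := Template.exists_critical hA hM hk (k - 2) (by omega)
    have := hST.lt hA (by omega)
    omega
  · rcases lt_or_ge 1 k with hk' | hk'
    · have := PortGraph.pos_of_hasRunningTime hA hM hk'
      omega
    · omega

/-! ### From message passing to local outputs. -/

namespace EdgeColouredGraph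

variable {k : ℕ} {V : Type*} {G : EdgeColouredGraph k V}

theorem Link.symm {c : Fin k} {u v : V} (h : G.Link c u v) : G.Link c v u := by
  obtain ⟨h, rfl⟩ := h
  exact ⟨h.symm, SimpleGraph.EdgeLabeling.get_comm _ _ _⟩

theorem Link.right_unique {c : Fin k} {u v w : V} (hv : G.Link c u v) (hw : G.Link c u w) :
    v = w := by
  obtain ⟨hv, rfl⟩ := hv
  obtain ⟨hw, hc⟩ := hw
  exact G.proper u v w hv hw hc.symm

theorem Link.colour_unique {c d : Fin k} {u v : V} (h : G.Link c u v) (h' : G.Link d u v) :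
    c = d := by
  obtain ⟨_, rfl⟩ := h
  obtain ⟨_, rfl⟩ := h'
  rfl

end EdgeColouredGraph

namespace MessagePassing

variable {k : ℕ} {V : Type*} {A : MessagePassing.{u₁, u₂} k} {G : EdgeColouredGraph k V}

theorem inbox_of_link {s : V → A.State} {c : Fin k} {v w : V} (h : G.Link c v w) :
    A.inbox G s v c = some (A.send (s w) c) := by
  have hex : ∃ w, G.Link c v w := ⟨w, h⟩
  rw [inbox, dif_pos hex, h.right_unique hex.choose_spec]

theorem inbox_of_not {s : V → A.State} {c : Fin k} {v : V} (h : ¬ ∃ w, G.Link c v w) :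
    A.inbox G s v c = none :=
  dif_neg h

end MessagePassing

namespace ColourGroup

variable {k : ℕ}

/-- The subgraph of the Cayley graph of `G_k` that is induced by a set of elements. -/
def inducedGraph (U : Set (ColourGroup k)) : SimpleGraph U where
  Adj u v := ∃ c : Fin k, (v : ColourGroup k) = (u : ColourGroup k) * gen c
  symm := ⟨by
    rintro u v ⟨c, h⟩
    exact ⟨c, by rw [h, mul_gen_mul_gen]⟩⟩
  loopless := ⟨by
    rintro u ⟨c, h⟩
    exact gen_ne_one c (mul_eq_left.1 h.symm)⟩

theorem eq_mul_gen_of_eq_mul_gen {c : Fin k} {x y : ColourGroup k} (h : y = x * gen c) :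
    x = y * gen c := by
  rw [h, mul_gen_mul_gen]

theorem colour_eq_of_mul_gen {c d : Fin k} {x y : ColourGroup k} (h : y = x * gen c)
    (h' : y = x * gen d) : c = d :=
  gen_injective (mul_left_cancel (h.symm.trans h'))

/-- The subgraph of the Cayley graph of `G_k` that is induced by a set of elements, with its
natural edge colouring. -/
noncomputable def inducedColouredGraph (U : Set (ColourGroup k)) : EdgeColouredGraph k U where
  graph := inducedGraph U
  colour := SimpleGraph.EdgeLabeling.mk (fun _ _ h => Exists.choose h) (by
    intro x y h
    exact colour_eq_of_mul_gen (Exists.choose_spec h.symm)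
      (eq_mul_gen_of_eq_mul_gen (Exists.choose_spec h)))
  proper := by
    intro u v w hv hw h
    rw [SimpleGraph.EdgeLabeling.get_mk, SimpleGraph.EdgeLabeling.get_mk] at h
    apply Subtype.ext
    rw [Exists.choose_spec hv, Exists.choose_spec hw, h]

theorem link_inducedColouredGraph {U : Set (ColourGroup k)} {c : Fin k} {u v : U} :
    (inducedColouredGraph U).Link c u v ↔
      (v : ColourGroup k) = (u : ColourGroup k) * gen c := by
  constructor
  · rintro ⟨h, rfl⟩
    exact Exists.choose_spec h
  · intro h
    have hadj : (inducedGraph U).Adj u v := ⟨c, h⟩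
    exact ⟨hadj, colour_eq_of_mul_gen (Exists.choose_spec hadj) h⟩

theorem exists_link_inducedColouredGraph {U : Set (ColourGroup k)} {c : Fin k} {u : U} :
    (∃ v, (inducedColouredGraph U).Link c u v) ↔ (u : ColourGroup k) * gen c ∈ U := by
  simp only [link_inducedColouredGraph]
  constructor
  · rintro ⟨v, hv⟩
    rw [← hv]
    exact v.2
  · intro h
    exact ⟨⟨_, h⟩, rfl⟩

end ColourGroup

namespace MessagePassing

open ColourGroup

variable {k : ℕ}

/-- After `t` rounds the state of a node depends only on its neighbourhood of radius `t + 1`. -/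
theorem state_inducedColouredGraph (A : MessagePassing.{u₁, u₂} k) {U V : Set (ColourGroup k)}
    (t : ℕ) (u : U) (v : V)
    (h : ∀ x, len x ≤ t + 1 → ((u : ColourGroup k) * x ∈ U ↔ (v : ColourGroup k) * x ∈ V)) :
    A.state (inducedColouredGraph U) t u = A.state (inducedColouredGraph V) t v := by
  induction t generalizing u v with
  | zero =>
    simp only [state, exists_link_inducedColouredGraph]
    congr 1
    ext c
    exact h _ (by simp)
  | succ t ih =>
    have hs := ih u v fun x hx => h x (by omega)
    have hin : A.inbox (inducedColouredGraph U) (A.state (inducedColouredGraph U) t) u =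
        A.inbox (inducedColouredGraph V) (A.state (inducedColouredGraph V) t) v := by
      funext c
      have hc := h (gen c) (by simp)
      by_cases hu : (u : ColourGroup k) * gen c ∈ U
      · have hv := hc.1 hu
        rw [inbox_of_link (link_inducedColouredGraph (v := ⟨_, hu⟩) |>.2 rfl),
          inbox_of_link (link_inducedColouredGraph (v := ⟨_, hv⟩) |>.2 rfl)]
        congr 2
        refine ih _ _ fun x hx => ?_
        rw [mul_assoc, mul_assoc]
        have := len_gen_mul_le c x
        exact h _ (by omega)
      · have hv : (v : ColourGroup k) * gen c ∉ V := fun h' => hu (hc.2 h')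
        rw [inbox_of_not (by rwa [exists_link_inducedColouredGraph]),
          inbox_of_not (by rwa [exists_link_inducedColouredGraph])]
    simp only [state, hs, hin]

/-- The local outputs of a distributed algorithm after `r` rounds in colour systems. -/
noncomputable def localOutput (A : MessagePassing.{u₁, u₂} k) (r : ℕ) : LocalOutput k :=
  -- `join` gives a node that is still running the default output `none`.
  fun V v => (A.output (A.state (inducedColouredGraph V.carrier) r v)).join

theorem hasRunningTime_localOutput (A : MessagePassing.{u₁, u₂} k) (r : ℕ) :
    (A.localOutput r).HasRunningTime r := by
  intro U V u v h
  unfold localOutput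
  rw [A.state_inducedColouredGraph r u v]
  intro x hx
  have := Set.ext_iff.1 h x
  simpa [ColourSystem.view, hx] using this

/-- The matching conditions at a node involve only the node and its neighbours, so they can be
checked in a finite ball of the tree, where the hypothesis applies. -/
theorem findsMaximalMatching_localOutput (A : MessagePassing.{u₁, u₂} k) (r : ℕ)
    (hA : ∀ (V : Type) [Finite V] (G : EdgeColouredGraph k V),
      ∃ o : V → Option (Fin k), A.StopsWithin G r o ∧ G.IsMaximalMatching o)
    (V : ColourSystem k) : (A.localOutput r).FindsMaximalMatching V := by
  have key : ∀ v : V.carrier, ∃ (U : Set (ColourGroup k)) (o : U → Option (Fin k)),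
      (inducedColouredGraph U).IsMaximalMatching o ∧ U ⊆ V.carrier ∧
      ∀ x, len x ≤ 1 → ∀ h : (v : ColourGroup k) * x ∈ V.carrier,
        ∃ h' : (v : ColourGroup k) * x ∈ U, A.localOutput r V ⟨_, h⟩ = o ⟨_, h'⟩ := by
    intro v
    -- Radius r + 2 contains the radius r + 1 views of `v` and of all its neighbours.
    let U : Set (ColourGroup k) := {y | y ∈ V.carrier ∧ len ((v : ColourGroup k)⁻¹ * y) ≤ r + 2}
    have hU : U.Finite := by
      refine ((finite_setOf_len_le (r + 2)).image fun x => (v : ColourGroup k) * x).subset ?_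
      rintro y ⟨-, hy⟩
      exact ⟨_, hy, by simp⟩
    have : Finite U := hU
    obtain ⟨o, ho, hm⟩ := hA U (inducedColouredGraph U)
    refine ⟨U, o, hm, fun y hy => hy.1, fun x hx h => ?_⟩
    have h' : (v : ColourGroup k) * x ∈ U := ⟨h, by rw [inv_mul_cancel_left]; omega⟩
    refine ⟨h', ?_⟩
    unfold localOutput
    rw [A.state_inducedColouredGraph r ⟨_, h⟩ (⟨_, h'⟩ : U), ho]
    · rfl
    · intro y hy
      refine ⟨fun hV => ⟨hV, ?_⟩, fun hV => hV.1⟩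
      have := len_mul_le x y
      rw [mul_assoc, inv_mul_cancel_left]
      omega
  constructor
  · intro v c hc
    obtain ⟨U, o, hm, hUV, hU⟩ := key v
    obtain ⟨hv, hov⟩ := hU 1 (by simp) (by simp)
    simp only [mul_one] at hv hov
    obtain ⟨w, hw, how⟩ := hm.1 ⟨v, hv⟩ c (hov.symm.trans hc)
    rw [link_inducedColouredGraph] at hw
    have hmem : (v : ColourGroup k) * gen c ∈ V.carrier := by
      rw [← hw]
      exact hUV w.2
    refine ⟨hmem, ?_⟩
    obtain ⟨h', hoc⟩ := hU (gen c) (by simp) hmem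
    rw [hoc, ← how]
    congr 1
    exact Subtype.ext hw.symm
  · intro v c h hv0 hvc
    obtain ⟨U, o, hm, hUV, hU⟩ := key v
    obtain ⟨hv, hov⟩ := hU 1 (by simp) (by simp)
    simp only [mul_one] at hv hov
    obtain ⟨h', hoc⟩ := hU (gen c) (by simp) h
    have hadj : (inducedColouredGraph U).graph.Adj ⟨v, hv⟩ ⟨_, h'⟩ := ⟨c, rfl⟩
    exact hm.2 _ _ hadj (hov.symm.trans hv0) (hoc.symm.trans hvc)

end MessagePassing

/-! ### The greedy matching and the algorithm that computes it. -/

namespace EdgeColouredGraph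

variable {k : ℕ} {V : Type*} {G : EdgeColouredGraph k V}

theorem greedySteps_mono (G : EdgeColouredGraph k V) : Monotone G.greedySteps :=
  monotone_nat_of_le_succ fun _ => Set.subset_union_left

theorem exists_link_of_mem_greedySteps {i : ℕ} {e : Sym2 V} (he : e ∈ G.greedySteps i) :
    ∃ c u v, G.Link c u v ∧ e = s(u, v) := by
  induction i with
  | zero => exact absurd he (Set.notMem_empty e)
  | succ i ih =>
    rcases he with he | ⟨c, u, v, -, h, he, -⟩
    · exact ih he
    · exact ⟨c, u, v, h, he⟩

/-- The local outputs describe the greedy matching after `i` steps. -/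
def IsGreedyAt (G : EdgeColouredGraph k V) (i : ℕ) (o : V → Option (Fin k)) : Prop :=
  ∀ v c, o v = some c ↔ ∃ w, G.Link c v w ∧ s(v, w) ∈ G.greedySteps i

theorem isGreedyAt_zero : G.IsGreedyAt 0 fun _ => none := by
  intro v c
  simp [greedySteps]

theorem IsGreedyAt.eq_none_iff {i : ℕ} {o : V → Option (Fin k)} (ho : G.IsGreedyAt i o) (v : V) :
    o v = none ↔ ∀ f ∈ G.greedySteps i, v ∉ f := by
  constructor
  · intro hv f hf hvf
    obtain ⟨c, u, w, hl, rfl⟩ := exists_link_of_mem_greedySteps hf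
    rcases Sym2.mem_iff.1 hvf with rfl | rfl
    · rw [(ho _ c).2 ⟨w, hl, hf⟩] at hv
      simp at hv
    · rw [(ho _ c).2 ⟨u, hl.symm, by rwa [Sym2.eq_swap]⟩] at hv
      simp at hv
  · intro h
    by_contra hv
    obtain ⟨c, hc⟩ := Option.ne_none_iff_exists'.1 hv
    obtain ⟨w, -, hw⟩ := (ho v c).1 hc
    exact h _ hw (Sym2.mem_mk_left v w)

theorem IsGreedyAt.succ {i : ℕ} {o o' : V → Option (Fin k)} (ho : G.IsGreedyAt i o)
    (h : ∀ v c, o' v = some c ↔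
      o v = some c ∨ (o v = none ∧ (c : ℕ) = i ∧ ∃ w, G.Link c v w ∧ o w = none)) :
    G.IsGreedyAt (i + 1) o' := by
  intro v c
  rw [h]
  constructor
  · rintro (hv | ⟨hv, hc, w, hl, hw⟩)
    · obtain ⟨w, hl, hw⟩ := (ho v c).1 hv
      exact ⟨w, hl, Or.inl hw⟩
    · rw [ho.eq_none_iff] at hv hw
      exact ⟨w, hl, Or.inr ⟨c, v, w, hc, hl, rfl, fun f hf => ⟨hv f hf, hw f hf⟩⟩⟩
  · rintro ⟨w, hl, hw | ⟨d, a, b, hd, hab, he, hf⟩⟩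
    · exact Or.inl ((ho v c).2 ⟨w, hl, hw⟩)
    · have ha : o a = none := (ho.eq_none_iff a).2 fun f hf' => (hf f hf').1
      have hb : o b = none := (ho.eq_none_iff b).2 fun f hf' => (hf f hf').2
      right
      rcases Sym2.eq_iff.1 he with ⟨rfl, rfl⟩ | ⟨rfl, rfl⟩
      · obtain rfl := hab.colour_unique hl
        exact ⟨ha, hd, _, hl, hb⟩
      · obtain rfl := hab.symm.colour_unique hl
        exact ⟨hb, hd, _, hl, ha⟩

/-- An edge with both ends unmatched at the end had both ends unmatched at the step of its own
colour, and would have been added then. -/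
theorem IsGreedyAt.isMaximalMatching {o : V → Option (Fin k)} (ho : G.IsGreedyAt k o) :
    G.IsMaximalMatching o := by
  constructor
  · intro v c hc
    obtain ⟨w, hl, hw⟩ := (ho v c).1 hc
    exact ⟨w, hl, (ho w c).2 ⟨v, hl.symm, by rwa [Sym2.eq_swap]⟩⟩
  · intro v w hadj hv hw
    rw [ho.eq_none_iff] at hv hw
    let c := G.colour.get v w hadj
    have hle : G.greedySteps c ⊆ G.greedySteps k := G.greedySteps_mono c.2.le
    have hlt : G.greedySteps (c + 1) ⊆ G.greedySteps k := G.greedySteps_mono c.2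
    exact hv s(v, w) (hlt (Or.inr ⟨c, v, w, rfl, ⟨hadj, rfl⟩, rfl,
      fun f hf => ⟨hv f (hle hf), hw f (hle hf)⟩⟩)) (Sym2.mem_mk_left v w)

end EdgeColouredGraph

namespace MessagePassing

variable {k : ℕ}

open Classical in
/-- An unmatched node chooses the colour number `i` if it belongs to the set `S`. -/
noncomputable def advance (i : ℕ) (S : Set (Fin k)) (o : Option (Fin k)) : Option (Fin k) :=
  if h : o = none ∧ ∃ c ∈ S, (c : ℕ) = i then some h.2.choose else o

theorem advance_eq_some_iff {i : ℕ} {S : Set (Fin k)} {o : Option (Fin k)} {c : Fin k} :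
    advance i S o = some c ↔ o = some c ∨ (o = none ∧ (c : ℕ) = i ∧ c ∈ S) := by
  unfold advance
  split_ifs with h
  · obtain ⟨hS, hi⟩ := h.2.choose_spec
    simp only [h.1, Option.some.injEq, reduceCtorEq, true_and, false_or]
    constructor
    · intro hc
      rw [← hc]
      exact ⟨hi, hS⟩
    · rintro ⟨hc, -⟩
      exact Fin.ext (hi.trans hc.symm)
  · constructor
    · exact Or.inl
    · rintro (hc | ⟨ho, hc, hS⟩)
      · exact hc
      · exact absurd ⟨ho, c, hS, hc⟩ h

/-- The greedy algorithm. The state consists of the number of completed rounds and the colour along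
which the node is matched so far; in each round a node tells its neighbours whether it is
unmatched. -/
noncomputable def greedy (k : ℕ) : MessagePassing.{0, 0} k where
  State := ℕ × Option (Fin k)
  Message := Bool
  -- Before the step of colour number 0 everything is unmatched, so the incident colours alone
  -- decide this step; this saves one of the k rounds.
  start C := (0, advance 0 C none)
  send s _ := s.2.isNone
  update s m := (s.1 + 1, advance (s.1 + 1) {c | m c = some true} s.2)
  output s := if s.1 < k - 1 then none else some s.2

variable {V : Type*} (G : EdgeColouredGraph k V)

theorem inbox_greedy (s : V → (greedy k).State) (v : V) (c : Fin k) :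
    (greedy k).inbox G s v c = some true ↔ ∃ w, G.Link c v w ∧ (s w).2 = none := by
  by_cases h : ∃ w, G.Link c v w
  · obtain ⟨w, hw⟩ := h
    rw [inbox_of_link hw]
    simp only [greedy, Option.some.injEq, Option.isNone_iff_eq_none]
    constructor
    · exact fun hs => ⟨w, hw, hs⟩
    · rintro ⟨w', hw', hs⟩
      rwa [hw.right_unique hw']
  · rw [inbox_of_not h]
    simp only [reduceCtorEq, false_iff]
    exact fun ⟨w, hw, _⟩ => h ⟨w, hw⟩

/-- The index t + 1 records that t rounds complete t + 1 greedy steps. Up to round k - 1 no node has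
stopped earlier, so all counters stay synchronised. -/
theorem state_greedy (t : ℕ) (ht : t ≤ k - 1) :
    (∀ v, ((greedy k).state G t v).1 = t) ∧
      G.IsGreedyAt (t + 1) fun v => ((greedy k).state G t v).2 := by
  induction t with
  | zero =>
    refine ⟨fun v => rfl, EdgeColouredGraph.isGreedyAt_zero.succ fun v c => ?_⟩
    refine advance_eq_some_iff.trans ?_
    simp
  | succ t ih =>
    obtain ⟨h1, h2⟩ := ih (by omega)
    have hs : ∀ v, (greedy k).state G (t + 1) v =
        (t + 1, advance (t + 1) {c | (greedy k).inbox G ((greedy k).state G t) v c = some true}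
          ((greedy k).state G t v).2) := by
      intro v
      have hrun : (greedy k).output ((greedy k).state G t v) = none := by
        simp only [greedy] at h1 ⊢
        rw [if_pos]
        rw [h1]
        omega
      rw [state, if_pos hrun]
      change (((greedy k).state G t v).1 + 1, advance (((greedy k).state G t v).1 + 1) _ _) = _
      rw [h1]
      rfl
    refine ⟨fun v => by rw [hs], h2.succ fun v c => ?_⟩
    rw [hs]
    refine advance_eq_some_iff.trans ?_
    simp only [Set.mem_ofPred_eq, inbox_greedy]

end MessagePassing

theorem mainTheorem1 (k : ℕ) (hk : 0 < k) :
    -- lower bound for message passing, already if correctness is required in finite graphs only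
    (∀ (A : MessagePassing.{u₁, u₂} k) (r : ℕ),
      (∀ (V : Type) [Finite V] (G : EdgeColouredGraph k V),
        ∃ o : V → Option (Fin k), A.StopsWithin G r o ∧ G.IsMaximalMatching o) →
      k - 1 ≤ r) ∧
    -- lower bound for functions of the local neighbourhoods in colour systems
    (∀ (A : LocalOutput k) (r : ℕ), A.HasRunningTime r →
      (∀ V : ColourSystem k, A.FindsMaximalMatching V) → k - 1 ≤ r) ∧
    -- the greedy algorithm attains the bound, in all graphs
    (∃ A : MessagePassing.{0, 0} k,
      ∀ (V : Type u₃) (G : EdgeColouredGraph k V),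
        ∃ o : V → Option (Fin k), A.StopsWithin G (k - 1) o ∧ G.IsMaximalMatching o ∧
          ∀ v c, o v = some c ↔ ∃ w, G.Link c v w ∧ s(v, w) ∈ G.greedyMatching) := by
  refine ⟨fun A r hA => ?_, fun A r hA hM => LocalOutput.le_of_findsMaximalMatching hA hM,
    MessagePassing.greedy k, fun V G => ?_⟩
  · exact LocalOutput.le_of_findsMaximalMatching (A.hasRunningTime_localOutput r)
      (A.findsMaximalMatching_localOutput r hA)
  · obtain ⟨h1, h2⟩ := MessagePassing.state_greedy G (k - 1) le_rfl
    rw [Nat.sub_add_cancel hk] at h2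
    exact ⟨_, fun v => if_neg (by rw [h1]; exact lt_irrefl _), h2.isMaximalMatching, h2⟩
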